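/- A plane increasing tree of size $n$ is a rooted plane tree (the children of every node are ordered) whose nodes are labelled $1,\dots,n$ so that labels increase along every path leading away from the root. Given real numbers $(\phi_i)_{i\ge 0}$, the weight of a tree $T$ is $\omega(T)=\prod_{v\in T}\phi_{d(v)}$, where $d(v)$ is the number of children of $v$; let $y_n$ be the total weight of all plane increasing trees of size $n$ and $y(x)=\sum_{n\ge1}y_nx^n/n!$. Assume that the family is very simple, i.e. that there are reals $c_1>0$ and $\alpha>0$ with $$y'(x)=(1-c_1x)^{-\alpha}$$ as formal power series (hence $y_n>0$ for all $n\ge1$). For an event $E$, let $\mathbb P_n(E)$ be the probability of $E$ for a tree of size $n$ drawn with probability proportional to its weight, that is, the total weight of the trees of size $n$ in $E$ divided by $y_n$ (this ratio is also meant if some $\phi_i$ are negative). A descendant of a node $v$ is a node other than $v$ whose path to the root contains $v$. For $1/2\le\sigma<1$ let $\Lambda_k(\sigma)$ be the event that the node with label $k$ has at least $\lfloor\sigma n\rfloor$ descendants. Let $$I_x(a,b)=\frac{\int_0^x t^{a-1}(1-t)^{b-1}\,dt}{\int_0^1 t^{a-1}(1-t)^{b-1}\,dt}$$ be the regularised incomplete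 beta function. **Theorem.** For every $\delta\in(0,1/2)$ there is a constant $C$ (depending only on the family and on $\delta$) such that for every sequence of non-negative integers $k=k(n)$ with $k=o(n^{1/4})$ the following holds for all sufficiently large $n$ (how large may depend on the sequence): for every $\sigma\in[1/2,1-\delta)$ with $1<k<\lceil(1-\sigma)n\rceil$, $$\mathbb P_n(\Lambda_k(\sigma))=I_{1-\sigma}(k-1,\alpha)\,(1+\varepsilon)\quad\text{for some }\varepsilon\text{ with } |\varepsilon|\le C\,\frac{k^2}{\sqrt n}.$$ **Corollary.** There is a constant $C$ such that for every sequence $k=k(n)$ with $k=o(n^{1/4})$ and $k(n)>1$ for all large $n$: for all sufficiently large $n$, the probability that node $k$ lies on the path (ends included) from the root to the centroid nearest to the root equals $I_{1/2}(k-1,\alpha)(1+\varepsilon)$ for some $\varepsilon$ with $|\varepsilon|\le Ck^2/\sqrt n$; moreover $\mathbb P_n(\Lambda_k(1/2))\sim I_{1/2}(k-1,\alpha)$ as $n\to\infty$. Here a centroid is a node whose average distance to the other nodes is minimal. -/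

import Mathlib

open Filter Asymptotics

/-- An increasing tree on the nodes labelled `1, …, n`, without an order on siblings. The node with
label `k` is the element of `Fin n` of value `k - 1`, and the tree is given by its parent map: the
root (label `1`) is sent to itself, and any other node to a node with a smaller label. -/
def IncreasingTree (n : ℕ) : Type :=
  {p : Fin n → Fin n // ∀ v, (v.val = 0 → p v = v) ∧ (0 < v.val → p v < v)}

namespace IncreasingTree

instance (n : ℕ) : Fintype (IncreasingTree n) :=
  inferInstanceAs (Fintype {p : Fin n → Fin n //
    ∀ v, (v.val = 0 → p v = v) ∧ (0 < v.val → p v < v)})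

variable {n : ℕ}

/-- The parent of a node (the root itself for the root). -/
def parent (t : IncreasingTree n) : Fin n → Fin n := t.1

/-- The children of the node `v`. -/
def children (t : IncreasingTree n) (v : Fin n) : Finset (Fin n) :=
  Finset.univ.filter fun w => 0 < w.val ∧ t.parent w = v

/-- The number of children of the node `v`. -/
def outdegree (t : IncreasingTree n) (v : Fin n) : ℕ := (t.children v).card

/-- `v` lies on the path from the root to `w`, both ends included. -/
def OnPathFromRoot (t : IncreasingTree n) (v w : Fin n) : Prop := ∃ i : ℕ, t.parent^[i] w = v

open Classical in
/-- The descendants of `v`: the nodes other than `v` whose path from the root contains `v`. -/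
noncomputable def descendants (t : IncreasingTree n) (v : Fin n) : Finset (Fin n) :=
  Finset.univ.filter fun w => w ≠ v ∧ t.OnPathFromRoot v w

/-- The underlying undirected graph: every node other than the root is joined to its parent. -/
def graph (t : IncreasingTree n) : SimpleGraph (Fin n) :=
  SimpleGraph.fromRel fun v w => t.parent v = w

/-- A centroid: a node whose total (equivalently, average) distance to the other nodes
is minimal. -/
def IsCentroid (t : IncreasingTree n) (c : Fin n) : Prop :=
  ∀ w, ∑ u, t.graph.dist c u ≤ ∑ u, t.graph.dist w u

/-- A centroid that is nearest to the root among all centroids. -/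
def IsNearestCentroid (t : IncreasingTree n) (c : Fin n) : Prop :=
  t.IsCentroid c ∧
    ∀ r c' : Fin n, r.val = 0 → t.IsCentroid c' → t.graph.dist r c ≤ t.graph.dist r c'

end IncreasingTree

/-- A plane increasing tree with `n` nodes: an increasing tree in which the children of every node
are put in order (`e v i` is the `i`-th child of `v`). -/
def PlaneIncreasingTree (n : ℕ) : Type :=
  Σ t : IncreasingTree n, ∀ v : Fin n, Fin (t.outdegree v) ≃ {w : Fin n // w ∈ t.children v}

namespace PlaneIncreasingTree

instance (n : ℕ) : Fintype (PlaneIncreasingTree n) :=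
  inferInstanceAs (Fintype (Σ t : IncreasingTree n,
    ∀ v : Fin n, Fin (t.outdegree v) ≃ {w : Fin n // w ∈ t.children v}))

variable {n : ℕ}

/-- The increasing tree underlying a plane increasing tree. -/
def tree (T : PlaneIncreasingTree n) : IncreasingTree n := T.1

/-- The weight of a tree: the product over its nodes of `φ i`, with `i` the outdegree. -/
def weight (φ : ℕ → ℝ) (T : PlaneIncreasingTree n) : ℝ := ∏ v, φ (T.tree.outdegree v)

/-- The event that the node with label `k` has at least `⌊σ n⌋` descendants. -/
def Lam (k : ℕ) (σ : ℝ) (T : PlaneIncreasingTree n) : Prop :=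
  ∃ v : Fin n, v.val + 1 = k ∧ ⌊σ * (n : ℝ)⌋₊ ≤ (T.tree.descendants v).card

/-- The event that the node with label `k` is on the path from the root to the
nearest centroid. -/
def OnCentroidPath (k : ℕ) (T : PlaneIncreasingTree n) : Prop :=
  ∃ v c : Fin n, v.val + 1 = k ∧ T.tree.IsNearestCentroid c ∧ T.tree.OnPathFromRoot v c

end PlaneIncreasingTree

/-- The total weight `y_n` of all plane increasing trees with `n` nodes. -/
noncomputable def totalWeight (φ : ℕ → ℝ) (n : ℕ) : ℝ :=
  ∑ T : PlaneIncreasingTree n, T.weight φ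

open Classical in
/-- The probability of the event `E` for a tree of size `n` that is drawn at random according to
the weights: the proportion of the total weight that is carried by the trees in `E`. (This ratio is
also used when some of the weights are negative.) -/
noncomputable def treeProb (φ : ℕ → ℝ) (n : ℕ) (E : PlaneIncreasingTree n → Prop) : ℝ :=
  (∑ T ∈ Finset.univ.filter E, T.weight φ) / totalWeight φ n

/-- The exponential generating function `y(x) = ∑_{n ≥ 1} y_n x^n / n!`. -/
noncomputable def treeEGF (φ : ℕ → ℝ) : PowerSeries ℝ :=
  PowerSeries.mk fun n => if n = 0 then 0 else totalWeight φ n / (n.factorial : ℝ)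

/-- The formal power series `(1 - c x)^{-α}`. -/
noncomputable def oneSubPow (c α : ℝ) : PowerSeries ℝ :=
  PowerSeries.rescale (-c) (PowerSeries.binomialSeries ℝ (-α))

/-- The regularised incomplete beta function `I_x(a, b)`. -/
noncomputable def regIncBeta (x a b : ℝ) : ℝ :=
  (∫ t in (0 : ℝ)..x, t ^ (a - 1) * (1 - t) ^ (b - 1)) /
    ∫ t in (0 : ℝ)..1, t ^ (a - 1) * (1 - t) ^ (b - 1)

/-!
The trees of a very simple family grow one node at a time, with attachment rates that are affine
functions of the outdegree. Summing over the orders of siblings turns a plane tree into an unordered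
increasing tree in which a node with `d` children has weight `d! * φ d`. The total weights determine
these node weights, since among the trees with `d + 1` nodes only the star has a node of outdegree
`d` (`IncreasingTree.weight_eq_of_sum_eq`), so it suffices to exhibit weights with the prescribed
totals: the ones for which a new leaf at a node of outdegree `d` multiplies the weight by
`c * ((1 - α) * d + α)` (`IncreasingTree.growthWeight`, `IncreasingTree.sum_growthWeight`).

Summed over a subtree with `m + 1` nodes the attachment rates give `c * (m + α)`, whatever the shape
of the subtree, and summed over the nodes outside a subtree of a tree of size `n` they give
`c * (n - 1 - m)`. The subtree of the node `k` therefore grows as a Pólya urn with initial masses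
`α` and `k - 1`, and its number of descendants in a tree of size `n` has the beta-binomial law with
parameters `n - k`, `α`, `k - 1` (`IncreasingTree.sum_degreeWeight_descendants`).

Since `k - 1` is an integer, a term of this law is, up to the beta function, a product of `k - 2`
consecutive integers times a ratio of rising factorials that can be replaced by a power
`(1 - t) ^ (α - 1)`, with logarithmic error `O(k ^ 2 / n)` (`abs_log_tailFactor`). The product lies
between the `(k - 2)`-nd powers of its first and last factors, so the tail lies between two
integrals of the beta density over ranges whose ends differ from `0` and `1 - σ` by `O(k / n)`
(`tailSum_le`, `le_tailSum`). The upper bound stays inside `[0, 1 - σ]`, and the lower one loses a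
factor `1 - O(k ^ 2 / n)` (`le_integral_betaKernel_sub`). This gives the relative error
`O(k ^ 2 / n)`, which is below the required `O(k ^ 2 / √n)`.

For the centroid, moving from a node to its child `w` changes the total distance by `n` minus twice
the size of the subtree of `w` (`IncreasingTree.sum_dist_add_two_mul_card_subtree`). Hence the nodes
on the path from the root to the nearest centroid are those whose subtree has more than `n / 2`
nodes, and the event of the corollary is `Λ_k(1/2)` itself
(`PlaneIncreasingTree.onCentroidPath_iff_lam`).
-/

/-! ### Sums over plane trees as sums over unordered increasing trees -/

namespace IncreasingTree

variable {n : ℕ}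

/-- The product over the nodes of `ψ d`, with `d` the outdegree. With `ψ d = d! * φ d` this is the
total weight of all plane increasing trees with the underlying tree `t`. -/
noncomputable def degreeWeight (ψ : ℕ → ℝ) (t : IncreasingTree n) : ℝ := ∏ v, ψ (t.outdegree v)

end IncreasingTree

/-- A node with `d` children contributes a factor `d!`, the number of orders of its children. -/
theorem PlaneIncreasingTree.sum_weight (φ : ℕ → ℝ) (n : ℕ) (f : IncreasingTree n → ℝ) :
    ∑ T : PlaneIncreasingTree n, f T.tree * T.weight φ =
      ∑ t : IncreasingTree n, f t * t.degreeWeight (fun d => (d.factorial : ℝ) * φ d) := by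
  classical
  refine (Fintype.sum_sigma (fun T : PlaneIncreasingTree n => f T.tree * T.weight φ)).trans ?_
  refine Finset.sum_congr rfl fun t _ => ?_
  have h : ∀ e : (∀ v : Fin n, Fin (t.outdegree v) ≃ {w : Fin n // w ∈ t.children v}),
      f (PlaneIncreasingTree.tree ⟨t, e⟩) * PlaneIncreasingTree.weight φ ⟨t, e⟩
        = f t * ∏ v, φ (t.outdegree v) := fun e => rfl
  rw [Fintype.sum_congr _ _ h, Finset.sum_const, Finset.card_univ, nsmul_eq_mul]
  have hcard : Fintype.card (∀ v : Fin n, Fin (t.outdegree v) ≃ {w : Fin n // w ∈ t.children v})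
      = ∏ v, (t.outdegree v).factorial := by
    rw [Fintype.card_pi]
    refine Finset.prod_congr rfl fun v _ => ?_
    have e : Fin (t.outdegree v) ≃ {w : Fin n // w ∈ t.children v} :=
      Fintype.equivOfCardEq (by rw [Fintype.card_fin, Fintype.card_coe, IncreasingTree.outdegree])
    rw [Fintype.card_equiv e, Fintype.card_fin]
  rw [IncreasingTree.degreeWeight, Finset.prod_mul_distrib]
  have : (Fintype.card (∀ v : Fin n, Fin (t.outdegree v) ≃ {w : Fin n // w ∈ t.children v}) : ℝ)
      = ∏ v, ((t.outdegree v).factorial : ℝ) := by rw [hcard]; push_cast; rfl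
  rw [← this]; ring

theorem totalWeight_eq_sum_degreeWeight (φ : ℕ → ℝ) (n : ℕ) :
    totalWeight φ n =
      ∑ t : IncreasingTree n, t.degreeWeight (fun d => (d.factorial : ℝ) * φ d) := by
  simpa [totalWeight] using PlaneIncreasingTree.sum_weight φ n (fun _ => 1)

open Classical in
theorem treeProb_eq_sum_degreeWeight (φ : ℕ → ℝ) (n : ℕ) (E : IncreasingTree n → Prop) :
    treeProb φ n (fun T => E T.tree) =
      (∑ t : IncreasingTree n, (if E t then 1 else 0) *
        t.degreeWeight (fun d => (d.factorial : ℝ) * φ d)) / totalWeight φ n := by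
  rw [← PlaneIncreasingTree.sum_weight, treeProb, Finset.sum_filter]
  simp

/-! ### Attaching a new node to an increasing tree -/

namespace IncreasingTree

variable {n : ℕ}

theorem parent_lt (t : IncreasingTree n) {v : Fin n} (hv : 0 < v.val) : t.parent v < v :=
  (t.2 v).2 hv

theorem parent_of_val_eq_zero (t : IncreasingTree n) {v : Fin n} (hv : v.val = 0) :
    t.parent v = v :=
  (t.2 v).1 hv

theorem parent_le (t : IncreasingTree n) (v : Fin n) : t.parent v ≤ v := by
  rcases Nat.eq_zero_or_pos v.val with h | h
  · exact (t.parent_of_val_eq_zero h).le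
  · exact (t.parent_lt h).le

@[ext] theorem ext {s t : IncreasingTree n} (h : ∀ v, s.parent v = t.parent v) : s = t :=
  Subtype.ext (funext h)

theorem iterate_parent_le (t : IncreasingTree n) (i : ℕ) (v : Fin n) : t.parent^[i] v ≤ v := by
  induction i with
  | zero => exact le_rfl
  | succ i ih => rw [Function.iterate_succ_apply']; exact (t.parent_le _).trans ih

theorem OnPathFromRoot.refl (t : IncreasingTree n) (v : Fin n) : t.OnPathFromRoot v v := ⟨0, rfl⟩

theorem OnPathFromRoot.le {t : IncreasingTree n} {v w : Fin n} (h : t.OnPathFromRoot v w) :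
    v ≤ w := by
  obtain ⟨i, rfl⟩ := h
  exact t.iterate_parent_le i w

theorem OnPathFromRoot.trans {t : IncreasingTree n} {u v w : Fin n} (h : t.OnPathFromRoot u v)
    (h' : t.OnPathFromRoot v w) : t.OnPathFromRoot u w := by
  obtain ⟨i, rfl⟩ := h
  obtain ⟨j, rfl⟩ := h'
  exact ⟨i + j, Function.iterate_add_apply _ _ _ _⟩

theorem onPathFromRoot_parent (t : IncreasingTree n) (v : Fin n) :
    t.OnPathFromRoot (t.parent v) v := ⟨1, rfl⟩

theorem onPathFromRoot_iff (t : IncreasingTree n) (v w : Fin n) :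
    t.OnPathFromRoot v w ↔ w = v ∨ (0 < w.val ∧ t.OnPathFromRoot v (t.parent w)) := by
  constructor
  · rintro ⟨i, hi⟩
    rcases Nat.eq_zero_or_pos w.val with h | h
    · left
      rw [← hi, Function.iterate_fixed (t.parent_of_val_eq_zero h)]
    · cases i with
      | zero => exact Or.inl hi
      | succ i => exact Or.inr ⟨h, i, hi⟩
  · rintro (rfl | ⟨-, h⟩)
    · exact .refl t w
    · exact h.trans (t.onPathFromRoot_parent w)

theorem mem_descendants {t : IncreasingTree n} {v w : Fin n} :
    w ∈ t.descendants v ↔ w ≠ v ∧ t.OnPathFromRoot v w := by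
  simp [descendants]

theorem mem_descendants_iff_parent {t : IncreasingTree n} {v w : Fin n} :
    w ∈ t.descendants v ↔ 0 < w.val ∧ t.OnPathFromRoot v (t.parent w) := by
  rw [mem_descendants, onPathFromRoot_iff]
  constructor
  · rintro ⟨h, h' | h'⟩
    · exact absurd h' h
    · exact h'
  · rintro ⟨h, h'⟩
    exact ⟨fun e => absurd (e ▸ h'.le) (not_le.2 (t.parent_lt h)), .inr ⟨h, h'⟩⟩

/-- The tree obtained from `t` by attaching a new node with the largest label to the node `u`. -/
def extend (t : IncreasingTree n) (u : Fin n) : IncreasingTree (n + 1) :=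
  ⟨Fin.snoc (α := fun _ => Fin (n + 1)) (fun v => (t.parent v).castSucc) u.castSucc, by
    intro v
    induction v using Fin.lastCases with
    | last =>
      have := u.isLt
      simp only [Fin.snoc_last, Fin.val_last]
      exact ⟨fun h => by omega, fun _ => Fin.castSucc_lt_last u⟩
    | cast v =>
      simp only [Fin.snoc_castSucc, Fin.val_castSucc]
      exact ⟨fun h => by rw [t.parent_of_val_eq_zero h], fun h => t.parent_lt h⟩⟩

@[simp] theorem extend_parent_castSucc (t : IncreasingTree n) (u v : Fin n) :
    (t.extend u).parent v.castSucc = (t.parent v).castSucc :=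
  Fin.snoc_castSucc (α := fun _ => Fin (n + 1)) u.castSucc (fun v => (t.parent v).castSucc) v

@[simp] theorem extend_parent_last (t : IncreasingTree n) (u : Fin n) :
    (t.extend u).parent (Fin.last n) = u.castSucc :=
  Fin.snoc_last (α := fun _ => Fin (n + 1)) u.castSucc (fun v => (t.parent v).castSucc)

theorem parent_castSucc_lt_last (t : IncreasingTree (n + 1)) (v : Fin n) :
    (t.parent v.castSucc).val < n :=
  lt_of_le_of_lt (t.parent_le v.castSucc) v.isLt

/-- Every increasing tree with at least two nodes arises in exactly one way by attaching the node
with the largest label to a smaller tree. -/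
def extendEquiv (hn : 0 < n) : IncreasingTree n × Fin n ≃ IncreasingTree (n + 1) where
  toFun x := x.1.extend x.2
  invFun t :=
    (⟨fun v => (t.parent v.castSucc).castLT (t.parent_castSucc_lt_last v), fun v =>
      ⟨fun h => Fin.ext (by simp [t.parent_of_val_eq_zero (v := v.castSucc) h]),
        fun h => t.parent_lt (v := v.castSucc) h⟩⟩,
      (t.parent (Fin.last n)).castLT (t.parent_lt (v := Fin.last n) hn))
  left_inv x := by
    refine Prod.ext (IncreasingTree.ext fun v => ?_) ?_
    · change Fin.castLT ((x.1.extend x.2).parent v.castSucc) _ = _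
      simp
    · change Fin.castLT ((x.1.extend x.2).parent (Fin.last n)) _ = _
      simp
  right_inv t := by
    refine IncreasingTree.ext fun v => ?_
    induction v using Fin.lastCases with
    | last => rw [extend_parent_last]; rfl
    | cast v => rw [extend_parent_castSucc]; rfl

theorem sum_succ (hn : 0 < n) (f : IncreasingTree (n + 1) → ℝ) :
    ∑ t, f t = ∑ t : IncreasingTree n, ∑ u : Fin n, f (t.extend u) := by
  rw [← (extendEquiv hn).sum_comp, Fintype.sum_prod_type]
  rfl

theorem outdegree_eq_sum (t : IncreasingTree n) (v : Fin n) :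
    t.outdegree v = ∑ w : Fin n, if 0 < w.val ∧ t.parent w = v then 1 else 0 := by
  rw [outdegree, children, Finset.card_filter]

theorem outdegree_extend_castSucc (hn : 0 < n) (t : IncreasingTree n) (u v : Fin n) :
    (t.extend u).outdegree v.castSucc = t.outdegree v + if v = u then 1 else 0 := by
  rw [outdegree_eq_sum, outdegree_eq_sum, Fin.sum_univ_castSucc]
  simp [hn, eq_comm]

theorem outdegree_extend_last (t : IncreasingTree n) (u : Fin n) :
    (t.extend u).outdegree (Fin.last n) = 0 := by
  rw [outdegree, Finset.card_eq_zero, children, Finset.filter_eq_empty_iff]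
  rintro w - ⟨hw, h⟩
  have := (t.extend u).parent_lt hw
  rw [h] at this
  exact absurd this (not_lt.2 (Fin.le_last w))

/-- The outdegrees of the nodes in `S` count the nodes whose parent is in `S`. -/
theorem sum_outdegree (t : IncreasingTree n) (S : Finset (Fin n)) :
    ∑ u ∈ S, t.outdegree u = (Finset.univ.filter fun w => 0 < w.val ∧ t.parent w ∈ S).card := by
  rw [Finset.card_eq_sum_card_fiberwise (f := t.parent) (t := S)]
  · refine Finset.sum_congr rfl fun u hu => ?_
    rw [outdegree, children]
    congr 1
    ext w
    simp only [Finset.mem_filter, Finset.mem_univ, true_and]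
    constructor
    · rintro ⟨h, rfl⟩; exact ⟨⟨h, hu⟩, rfl⟩
    · rintro ⟨⟨h, -⟩, h'⟩; exact ⟨h, h'⟩
  · intro w hw
    simpa using (Finset.mem_filter.1 hw).2.2

theorem sum_outdegree_univ (hn : 0 < n) (t : IncreasingTree n) :
    ∑ u, t.outdegree u + 1 = n := by
  rw [sum_outdegree]
  obtain ⟨m, rfl⟩ := Nat.exists_eq_succ_of_ne_zero hn.ne'
  have : (Finset.univ.filter fun w : Fin (m + 1) => 0 < w.val ∧ t.parent w ∈ Finset.univ)
      = Finset.univ.erase 0 := by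
    ext w
    simp only [Finset.mem_filter, Finset.mem_univ, and_true, true_and, Finset.mem_erase, ne_eq,
      Fin.ext_iff, Fin.val_zero, Nat.pos_iff_ne_zero]
  rw [this, Finset.card_erase_of_mem (Finset.mem_univ _), Finset.card_univ, Fintype.card_fin]
  rfl

open Classical in
/-- The subtree of `v`: the descendants of `v`, and `v` itself. -/
noncomputable def subtree (t : IncreasingTree n) (v : Fin n) : Finset (Fin n) :=
  Finset.univ.filter fun w => t.OnPathFromRoot v w

theorem mem_subtree {t : IncreasingTree n} {v w : Fin n} :
    w ∈ t.subtree v ↔ t.OnPathFromRoot v w := by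
  simp [subtree]

theorem card_subtree (t : IncreasingTree n) (v : Fin n) :
    (t.subtree v).card = (t.descendants v).card + 1 := by
  classical
  have : t.subtree v = insert v (t.descendants v) := by
    ext w
    rw [Finset.mem_insert, mem_subtree, mem_descendants]
    by_cases h : w = v
    · simp [h, OnPathFromRoot.refl]
    · simp [h]
  rw [this, Finset.card_insert_of_notMem (fun h => (mem_descendants.1 h).1 rfl)]

theorem sum_outdegree_subtree (t : IncreasingTree n) (v : Fin n) :
    ∑ u ∈ t.subtree v, t.outdegree u = (t.descendants v).card := by
  rw [sum_outdegree]
  congr 1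
  ext w
  rw [mem_descendants_iff_parent]
  simp [mem_subtree]

theorem onPathFromRoot_extend_castSucc (t : IncreasingTree n) (u v w : Fin n) :
    (t.extend u).OnPathFromRoot v.castSucc w.castSucc ↔ t.OnPathFromRoot v w := by
  have h : ∀ i, (t.extend u).parent^[i] w.castSucc = (t.parent^[i] w).castSucc := by
    intro i
    induction i with
    | zero => rfl
    | succ i ih =>
      rw [Function.iterate_succ_apply', ih, extend_parent_castSucc, Function.iterate_succ_apply']
  simp [OnPathFromRoot, h]

open Classical in
theorem card_descendants_extend_castSucc (hn : 0 < n) (t : IncreasingTree n) (u v : Fin n) :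
    ((t.extend u).descendants v.castSucc).card
      = (t.descendants v).card + if u ∈ t.subtree v then 1 else 0 := by
  have h : ∀ {m : ℕ} (s : IncreasingTree m) (x : Fin m),
      (s.descendants x).card = ∑ w, if w ∈ s.descendants x then 1 else 0 := by
    intro m s x; simp
  rw [h, h, Fin.sum_univ_castSucc]
  congr 1
  · refine Finset.sum_congr rfl fun w _ => ?_
    simp only [mem_descendants, onPathFromRoot_extend_castSucc, ne_eq, Fin.castSucc_inj]
  · simp only [mem_descendants_iff_parent, extend_parent_last, onPathFromRoot_extend_castSucc,
      mem_subtree, Fin.val_last, hn, true_and]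

theorem descendants_last (t : IncreasingTree (n + 1)) : t.descendants (Fin.last n) = ∅ := by
  refine Finset.eq_empty_of_forall_notMem fun w hw => ?_
  obtain ⟨h, h'⟩ := mem_descendants.1 hw
  exact h (le_antisymm (Fin.le_last w) h'.le)

end IncreasingTree

/-! ### The weights of a very simple family -/

/-- The rising factorial `x (x + 1) ⋯ (x + n - 1)`. -/
noncomputable def risingFactorial (x : ℝ) (n : ℕ) : ℝ := (ascPochhammer ℝ n).eval x

@[simp] theorem risingFactorial_zero (x : ℝ) : risingFactorial x 0 = 1 := by
  simp [risingFactorial]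

theorem risingFactorial_succ (x : ℝ) (n : ℕ) :
    risingFactorial x (n + 1) = risingFactorial x n * (x + n) :=
  ascPochhammer_succ_eval n x

theorem risingFactorial_pos {x : ℝ} (hx : 0 < x) (n : ℕ) : 0 < risingFactorial x n :=
  ascPochhammer_pos n x hx

theorem coeff_oneSubPow (c α : ℝ) (n : ℕ) :
    PowerSeries.coeff n (oneSubPow c α) = c ^ n * risingFactorial α n / n.factorial := by
  have h : (n.factorial : ℝ) ≠ 0 := by positivity
  have h2 : (n.factorial : ℝ) * Ring.multichoose α n = risingFactorial α n := by
    rw [risingFactorial, ← Polynomial.ascPochhammer_smeval_eq_eval,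
      ← Ring.factorial_nsmul_multichoose_eq_ascPochhammer, nsmul_eq_mul]
  have h3 : (Int.negOnePow n : ℤˣ) • Ring.multichoose α n = (-1) ^ n * Ring.multichoose α n := by
    rw [Int.negOnePow_def, zpow_natCast, Units.smul_def]
    simp
  rw [oneSubPow, PowerSeries.coeff_rescale, PowerSeries.binomialSeries_coeff, Ring.choose_neg', h3,
    ← h2, smul_eq_mul, mul_one, ← mul_assoc, ← mul_pow, neg_mul_neg, mul_one]
  field_simp

namespace IncreasingTree

variable {n : ℕ}

/-- The weight `d! * φ d` of a node of outdegree `d` in the very simple family with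
`y' = (1 - c x) ^ (-α)`. -/
noncomputable def growthWeight (c α : ℝ) (d : ℕ) : ℝ :=
  ∏ i ∈ Finset.range d, c * ((1 - α) * i + α)

@[simp] theorem growthWeight_zero (c α : ℝ) : growthWeight c α 0 = 1 := by simp [growthWeight]

theorem growthWeight_succ (c α : ℝ) (d : ℕ) :
    growthWeight c α (d + 1) = growthWeight c α d * (c * ((1 - α) * d + α)) :=
  Finset.prod_range_succ _ _

/-- Attaching a leaf to a node of outdegree `d` multiplies the weight by an affine function of `d`:
the tree grows as in a preferential attachment process. -/
theorem degreeWeight_extend (c α : ℝ) (hn : 0 < n) (t : IncreasingTree n) (u : Fin n) :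
    (t.extend u).degreeWeight (growthWeight c α) =
      t.degreeWeight (growthWeight c α) * (c * ((1 - α) * t.outdegree u + α)) := by
  have h : ∀ v : Fin n, growthWeight c α ((t.extend u).outdegree v.castSucc)
      = growthWeight c α (t.outdegree v) *
        if v = u then c * ((1 - α) * t.outdegree v + α) else 1 := by
    intro v
    rw [outdegree_extend_castSucc hn]
    split_ifs with h
    · rw [growthWeight_succ]
    · rw [add_zero, mul_one]
  rw [degreeWeight, Fin.prod_univ_castSucc, outdegree_extend_last, growthWeight_zero, mul_one,
    Finset.prod_congr rfl fun v _ => h v, Finset.prod_mul_distrib, Finset.prod_ite_eq']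
  simp [degreeWeight]

/-- The total attachment rate of a subtree depends on its size only. -/
theorem sum_attachment_subtree (c α : ℝ) (t : IncreasingTree n) (v : Fin n) :
    ∑ u ∈ t.subtree v, c * ((1 - α) * t.outdegree u + α) =
      c * ((t.descendants v).card + α) := by
  rw [← Finset.mul_sum, Finset.sum_add_distrib, ← Finset.mul_sum, ← Nat.cast_sum,
    sum_outdegree_subtree, Finset.sum_const, card_subtree, nsmul_eq_mul]
  push_cast
  ring

theorem sum_attachment_univ (c α : ℝ) (hn : 0 < n) (t : IncreasingTree n) :
    ∑ u, c * ((1 - α) * t.outdegree u + α) = c * (α + n - 1) := by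
  have h : ((∑ u, t.outdegree u : ℕ) : ℝ) + 1 = n := by exact_mod_cast t.sum_outdegree_univ hn
  rw [← Finset.mul_sum, Finset.sum_add_distrib, ← Finset.mul_sum, ← Nat.cast_sum,
    Finset.sum_const, Finset.card_univ, Fintype.card_fin, nsmul_eq_mul, ← h]
  ring

instance : Unique (IncreasingTree 1) where
  default := ⟨id, fun v => ⟨fun _ => rfl, fun h => absurd v.isLt (by omega)⟩⟩
  uniq _ := IncreasingTree.ext fun _ => Subsingleton.elim _ _

theorem sum_degreeWeight_one (ψ : ℕ → ℝ) : ∑ t : IncreasingTree 1, t.degreeWeight ψ = ψ 0 := by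
  rw [Fintype.sum_unique, degreeWeight, Fin.prod_univ_one]
  congr 1

theorem sum_growthWeight_succ (c α : ℝ) (hn : 0 < n) :
    ∑ t : IncreasingTree (n + 1), t.degreeWeight (growthWeight c α) =
      (∑ t : IncreasingTree n, t.degreeWeight (growthWeight c α)) * (c * (α + n - 1)) := by
  rw [sum_succ hn, Finset.sum_mul]
  refine Finset.sum_congr rfl fun t _ => ?_
  rw [← sum_attachment_univ c α hn t, Finset.mul_sum]
  exact Finset.sum_congr rfl fun u _ => degreeWeight_extend c α hn t u

theorem sum_growthWeight (c α : ℝ) (n : ℕ) :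
    ∑ t : IncreasingTree (n + 1), t.degreeWeight (growthWeight c α) =
      c ^ n * risingFactorial α n := by
  induction n with
  | zero => rw [sum_degreeWeight_one]; simp
  | succ n ih =>
    rw [sum_growthWeight_succ c α n.succ_pos, ih, risingFactorial_succ]
    push_cast
    ring

/-- The star: every node other than the root is a child of the root. -/
def star (d : ℕ) : IncreasingTree (d + 1) :=
  ⟨fun _ => 0, fun _ => ⟨fun h => (Fin.ext h).symm, fun h => h⟩⟩

theorem outdegree_le (t : IncreasingTree (n + 1)) (v : Fin (n + 1)) : t.outdegree v ≤ n := by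
  have h : ∑ u, t.outdegree u + 1 = n + 1 := t.sum_outdegree_univ n.succ_pos
  have h' : t.outdegree v ≤ ∑ u, t.outdegree u :=
    Finset.single_le_sum (fun i _ => Nat.zero_le _) (Finset.mem_univ v)
  omega

/-- In a tree with `n + 1` nodes other than the star all outdegrees are less than `n`. -/
theorem outdegree_lt_of_ne_star {t : IncreasingTree (n + 1)} (ht : t ≠ star n) (v : Fin (n + 1)) :
    t.outdegree v < n := by
  refine lt_of_le_of_ne (t.outdegree_le v) fun h => ht ?_
  have hch : t.children v = Finset.univ.erase 0 := by
    refine Finset.eq_of_subset_of_card_le (fun w hw => ?_) ?_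
    · have := (Finset.mem_filter.1 hw).2.1
      simp only [Finset.mem_erase, Finset.mem_univ, and_true, ne_eq, Fin.ext_iff, Fin.val_zero]
      omega
    · rw [Finset.card_erase_of_mem (Finset.mem_univ _), Finset.card_univ, Fintype.card_fin]
      exact h.ge
  have hpar : ∀ w : Fin (n + 1), 0 < w.val → t.parent w = v := fun w hw => by
    have : w ∈ t.children v := by
      rw [hch]
      simp only [Finset.mem_erase, Finset.mem_univ, and_true, ne_eq, Fin.ext_iff, Fin.val_zero]
      omega
    exact (Finset.mem_filter.1 this).2.2
  refine IncreasingTree.ext fun w => ?_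
  change t.parent w = 0
  rcases Nat.eq_zero_or_pos w.val with hw | hw
  · rw [t.parent_of_val_eq_zero hw]; exact Fin.ext hw
  · -- the node of value `1` forces `v` to be the root
    have h1 : 1 < n + 1 := by have := w.isLt; omega
    have := t.parent_lt (v := ⟨1, h1⟩) Nat.one_pos
    rw [hpar ⟨1, h1⟩ Nat.one_pos, Fin.lt_def] at this
    rw [hpar w hw]
    exact Fin.ext (by simpa using this)

theorem degreeWeight_star (ψ : ℕ → ℝ) (n : ℕ) :
    (star n).degreeWeight ψ = ψ n * ψ 0 ^ n := by
  have h0 : (star n).outdegree 0 = n := by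
    have : (star n).children 0 = Finset.univ.erase 0 := by
      ext w
      simp only [children, Finset.mem_filter, Finset.mem_univ, true_and, Finset.mem_erase,
        and_true, ne_eq, Fin.ext_iff, Fin.val_zero]
      constructor
      · rintro ⟨h, -⟩; omega
      · exact fun h => ⟨Nat.pos_of_ne_zero h, rfl⟩
    rw [outdegree, this, Finset.card_erase_of_mem (Finset.mem_univ _), Finset.card_univ,
      Fintype.card_fin]
    rfl
  have h1 : ∀ v : Fin n, (star n).outdegree v.succ = 0 := fun v => by
    rw [outdegree, Finset.card_eq_zero, children, Finset.filter_eq_empty_iff]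
    rintro w - ⟨-, hw⟩
    exact Fin.succ_ne_zero v hw.symm
  rw [degreeWeight, Fin.prod_univ_succ, h0]
  simp [h1]

/-- The total weights determine the node weights: `ψ d` enters the total weight of the trees with
`d + 1` nodes only through the star, next to values of `ψ` at smaller arguments. -/
theorem weight_eq_of_sum_eq {ψ ψ' : ℕ → ℝ} (h0 : ψ' 0 = 1)
    (h : ∀ n, ∑ t : IncreasingTree (n + 1), t.degreeWeight ψ =
      ∑ t : IncreasingTree (n + 1), t.degreeWeight ψ') : ψ = ψ' := by
  have h00 : ψ 0 = ψ' 0 := by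
    rw [← sum_degreeWeight_one ψ, ← sum_degreeWeight_one ψ']; exact h 0
  funext d
  induction d using Nat.strong_induction_on with
  | _ d ih =>
    have hd := h d
    have key : ∀ t : IncreasingTree (d + 1), t ≠ star d → t.degreeWeight ψ = t.degreeWeight ψ' :=
      fun t ht => Finset.prod_congr rfl fun v _ => ih _ (outdegree_lt_of_ne_star ht v)
    rw [← sub_eq_zero, ← Finset.sum_sub_distrib, Finset.sum_eq_single (star d)
      (fun t _ ht => by rw [key t ht, sub_self]) (fun h => absurd (Finset.mem_univ _) h),
      degreeWeight_star, degreeWeight_star, h00, h0, one_pow, mul_one, mul_one, sub_eq_zero] at hd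
    exact hd

/-- The generating function hypothesis pins down the weights. -/
theorem factorial_mul_eq_growthWeight {φ : ℕ → ℝ} {c α : ℝ}
    (hy : PowerSeries.derivative ℝ (treeEGF φ) = oneSubPow c α) :
    (fun d => (d.factorial : ℝ) * φ d) = growthWeight c α := by
  refine weight_eq_of_sum_eq (growthWeight_zero c α) fun n => ?_
  have h := congrArg (PowerSeries.coeff n) hy
  rw [coeff_oneSubPow, PowerSeries.coeff_derivative, treeEGF, PowerSeries.coeff_mk,
    if_neg n.succ_ne_zero, Nat.factorial_succ] at h
  have hn : (n.factorial : ℝ) ≠ 0 := by positivity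
  have hn' : (n : ℝ) + 1 ≠ 0 := by positivity
  rw [← totalWeight_eq_sum_degreeWeight, sum_growthWeight]
  push_cast at h
  field_simp at h
  exact h

/-! ### The law of the number of descendants -/

open Classical in
/-- One step of the urn: the new node joins the subtree of `v`, which has `m` descendants of `v`,
with total rate `c * (m + α)`, and the other nodes with total rate `c * (n - 1 - m)`. -/
theorem sum_extend_descendants (c α : ℝ) (hn : 0 < n) (t : IncreasingTree n) (v : Fin n)
    (f : ℕ → ℝ) :
    ∑ u, (t.extend u).degreeWeight (growthWeight c α) *
        f ((t.extend u).descendants v.castSucc).card =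
      t.degreeWeight (growthWeight c α) *
        (c * ((t.descendants v).card + α) * f ((t.descendants v).card + 1) +
          c * (n - 1 - (t.descendants v).card) * f (t.descendants v).card) := by
  have h1 := sum_attachment_univ c α hn t
  rw [← Finset.sum_add_sum_compl (t.subtree v), sum_attachment_subtree] at h1
  have h2 : ∑ u ∈ (t.subtree v)ᶜ, c * ((1 - α) * t.outdegree u + α) =
      c * (n - 1 - (t.descendants v).card) := by linarith
  rw [← Finset.sum_add_sum_compl (t.subtree v), mul_add, ← sum_attachment_subtree, ← h2,
    Finset.sum_mul, Finset.sum_mul, Finset.mul_sum, Finset.mul_sum]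
  congr 1
  · refine Finset.sum_congr rfl fun u hu => ?_
    rw [degreeWeight_extend c α hn, card_descendants_extend_castSucc hn, if_pos hu, mul_assoc]
  · refine Finset.sum_congr rfl fun u hu => ?_
    rw [degreeWeight_extend c α hn, card_descendants_extend_castSucc hn,
      if_neg (Finset.mem_compl.1 hu), mul_assoc, add_zero]

/-- The number of descendants of the node with label `b + 1` evolves as a Pólya urn that starts with
mass `α` for the subtree of the node and mass `b` for the remainder. After `N` steps its law is the
beta-binomial law. -/
theorem sum_degreeWeight_descendants (c α : ℝ) (b N : ℕ) (v : Fin (b + 1 + N)) (hv : v.val = b)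
    (f : ℕ → ℝ) :
    ∑ t : IncreasingTree (b + 1 + N),
        t.degreeWeight (growthWeight c α) * f (t.descendants v).card =
      c ^ b * risingFactorial α b * c ^ N * ∑ ij ∈ Finset.HasAntidiagonal.antidiagonal N,
        (N.choose ij.1 : ℝ) * (risingFactorial α ij.1 * risingFactorial b ij.2 * f ij.1) := by
  induction N generalizing f with
  | zero =>
    have hv' : v = Fin.last b := Fin.ext hv
    subst hv'
    have : ∀ t : IncreasingTree (b + 1), (t.descendants (Fin.last b)).card = 0 := fun t => by
      rw [descendants_last, Finset.card_empty]
    simp only [this, ← Finset.sum_mul, sum_growthWeight]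
    simp
  | succ N ih =>
    have hv' : b < b + 1 + N := by omega
    obtain rfl : v = (⟨b, hv'⟩ : Fin (b + 1 + N)).castSucc := Fin.ext hv
    have hpos : 0 < b + 1 + N := by omega
    refine (sum_succ hpos _).trans ?_
    simp_rw [sum_extend_descendants c α hpos]
    refine (ih ⟨b, hv'⟩ rfl fun m =>
      c * (m + α) * f (m + 1) + c * (((b + 1 + N : ℕ) : ℝ) - 1 - m) * f m).trans ?_
    rw [Finset.sum_antidiagonal_choose_succ_mul
      (fun i j => risingFactorial α i * risingFactorial b j * f i), ← Finset.sum_add_distrib,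
      pow_succ, ← mul_assoc, mul_assoc _ c, Finset.mul_sum, Finset.mul_sum, Finset.mul_sum]
    refine Finset.sum_congr rfl fun ij hij => ?_
    have hsum : ij.1 + ij.2 = N := Finset.HasAntidiagonal.mem_antidiagonal.1 hij
    have hch : N.choose ij.2 = N.choose ij.1 := by
      rw [← hsum, Nat.choose_symm_add]
    rw [hch, risingFactorial_succ, risingFactorial_succ, ← hsum]
    push_cast
    ring

end IncreasingTree

/-! ### Centroids -/

/-- If `xy` is the only edge that leaves the set `S` (with `x ∉ S` and `y ∈ S`), then every path
from outside `S` into `S` passes through it. -/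
theorem SimpleGraph.dist_succ_le_length_of_unique_crossing {V : Type*} {G : SimpleGraph V}
    {S : Set V} {x y : V}
    (hS : ∀ a a', G.Adj a a' → a ∉ S → a' ∈ S → a = x ∧ a' = y) {a u : V} (p : G.Walk a u)
    (ha : a ∉ S) (hu : u ∈ S) : G.dist y u + 1 ≤ p.length := by
  induction p with
  | nil => exact absurd hu ha
  | @cons a a' u h p ih =>
    rw [SimpleGraph.Walk.length_cons]
    by_cases ha' : a' ∈ S
    · obtain ⟨-, rfl⟩ := hS _ _ h ha ha'
      exact Nat.succ_le_succ (SimpleGraph.dist_le p)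
    · exact (ih ha' hu).trans (Nat.le_succ _)

theorem SimpleGraph.Connected.dist_succ_le_of_unique_crossing {V : Type*} {G : SimpleGraph V}
    (hG : G.Connected) {S : Set V} {x y : V}
    (hS : ∀ a a', G.Adj a a' → a ∉ S → a' ∈ S → a = x ∧ a' = y) {a u : V}
    (ha : a ∉ S) (hu : u ∈ S) : G.dist y u + 1 ≤ G.dist a u := by
  obtain ⟨p, hp⟩ := hG.exists_walk_length_eq_dist a u
  exact hp ▸ SimpleGraph.dist_succ_le_length_of_unique_crossing hS p ha hu

namespace IncreasingTree

variable {n : ℕ}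

theorem graph_adj_parent (t : IncreasingTree n) {v : Fin n} (hv : 0 < v.val) :
    t.graph.Adj (t.parent v) v := by
  rw [graph, SimpleGraph.fromRel_adj]
  exact ⟨(t.parent_lt hv).ne, .inr rfl⟩

theorem onPathFromRoot_root (t : IncreasingTree n) (r : Fin n) (hr : r.val = 0) (v : Fin n) :
    t.OnPathFromRoot r v := by
  induction h : v.val using Nat.strong_induction_on generalizing v with
  | _ m ih =>
    rw [onPathFromRoot_iff]
    rcases Nat.eq_zero_or_pos v.val with hv | hv
    · exact .inl (Fin.ext (hv.trans hr.symm))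
    · exact .inr ⟨hv, ih _ (h ▸ t.parent_lt hv) _ rfl⟩

theorem graph_reachable_of_onPathFromRoot {t : IncreasingTree n} {v w : Fin n}
    (h : t.OnPathFromRoot v w) : t.graph.Reachable v w := by
  obtain ⟨i, rfl⟩ := h
  induction i with
  | zero => exact .refl _
  | succ i ih =>
    rw [Function.iterate_succ_apply']
    rcases Nat.eq_zero_or_pos (t.parent^[i] w).val with h | h
    · rwa [t.parent_of_val_eq_zero h]
    · exact (t.graph_adj_parent h).reachable.trans ih

theorem graph_connected (hn : 0 < n) (t : IncreasingTree n) : t.graph.Connected := by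
  have : Nonempty (Fin n) := ⟨⟨0, hn⟩⟩
  have h := fun v => graph_reachable_of_onPathFromRoot (t.onPathFromRoot_root ⟨0, hn⟩ rfl v)
  exact ⟨fun v w => (h v).symm.trans (h w)⟩

theorem eq_of_adj_of_notMem_subtree {t : IncreasingTree n} {w a a' : Fin n}
    (h : t.graph.Adj a a') (ha : a ∉ t.subtree w) (ha' : a' ∈ t.subtree w) :
    a = t.parent w ∧ a' = w := by
  rw [mem_subtree] at ha ha'
  rw [graph, SimpleGraph.fromRel_adj] at h
  rcases h.2 with rfl | rfl
  · exact absurd (ha'.trans (t.onPathFromRoot_parent a)) ha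
  · rcases (t.onPathFromRoot_iff w a').1 ha' with rfl | ⟨-, h'⟩
    · exact ⟨rfl, rfl⟩
    · exact absurd h' ha

theorem dist_parent_of_mem {t : IncreasingTree n} {w u : Fin n} (hw : 0 < w.val)
    (hu : u ∈ t.subtree w) : t.graph.dist (t.parent w) u = t.graph.dist w u + 1 := by
  have hG := t.graph_connected w.pos
  refine le_antisymm ?_ (hG.dist_succ_le_of_unique_crossing (S := (t.subtree w : Set (Fin n)))
    (fun _ _ h h1 h2 => eq_of_adj_of_notMem_subtree h h1 h2) ?_ hu)
  · have := hG.dist_triangle (u := t.parent w) (v := w) (w := u)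
    rw [SimpleGraph.dist_eq_one_iff_adj.2 (t.graph_adj_parent hw)] at this
    omega
  · rw [Finset.mem_coe, mem_subtree]
    exact fun h => absurd h.le (not_le.2 (t.parent_lt hw))

theorem dist_of_notMem {t : IncreasingTree n} {w u : Fin n} (hw : 0 < w.val)
    (hu : u ∉ t.subtree w) : t.graph.dist w u = t.graph.dist (t.parent w) u + 1 := by
  have hG := t.graph_connected w.pos
  refine le_antisymm ?_ (hG.dist_succ_le_of_unique_crossing (S := (t.subtree w : Set (Fin n))ᶜ)
    (x := w) (fun a a' h h1 h2 => ?_) ?_ hu)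
  · have := hG.dist_triangle (u := w) (v := t.parent w) (w := u)
    rw [SimpleGraph.dist_eq_one_iff_adj.2 (t.graph_adj_parent hw).symm] at this
    omega
  · exact (eq_of_adj_of_notMem_subtree h.symm h2 (not_not.1 h1)).symm
  · exact not_not.2 (mem_subtree.2 (.refl t w))

/-- Moving from the parent of `w` to `w` brings the nodes of the subtree of `w` one step closer and
takes all other nodes one step further away. -/
theorem sum_dist_add_two_mul_card_subtree {t : IncreasingTree n} {w : Fin n} (hw : 0 < w.val) :
    ∑ u, t.graph.dist w u + 2 * (t.subtree w).card = ∑ u, t.graph.dist (t.parent w) u + n := by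
  have h1 : ∑ u ∈ t.subtree w, t.graph.dist (t.parent w) u =
      ∑ u ∈ t.subtree w, t.graph.dist w u + (t.subtree w).card := by
    rw [Finset.sum_congr rfl fun _ hu => dist_parent_of_mem hw hu, Finset.sum_add_distrib]
    simp
  have h2 : ∑ u ∈ (t.subtree w)ᶜ, t.graph.dist w u =
      ∑ u ∈ (t.subtree w)ᶜ, t.graph.dist (t.parent w) u + (t.subtree w)ᶜ.card := by
    rw [Finset.sum_congr rfl fun _ hu => dist_of_notMem hw (Finset.mem_compl.1 hu),
      Finset.sum_add_distrib]
    simp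
  have h3 : (t.subtree w).card + (t.subtree w)ᶜ.card = n := by
    rw [Finset.card_add_card_compl, Fintype.card_fin]
  rw [← Finset.sum_add_sum_compl (t.subtree w), ← Finset.sum_add_sum_compl (t.subtree w)
    (fun u => t.graph.dist (t.parent w) u)]
  omega

theorem OnPathFromRoot.subtree_subset {t : IncreasingTree n} {v w : Fin n}
    (h : t.OnPathFromRoot v w) : t.subtree w ⊆ t.subtree v := fun _ hu =>
  mem_subtree.2 (h.trans (mem_subtree.1 hu))

/-- Two subtrees with more than half of the nodes intersect, so one of them contains the other. -/
theorem onPathFromRoot_or_of_lt_card_subtree {t : IncreasingTree n} {v w : Fin n}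
    (hv : n < 2 * (t.subtree v).card) (hw : n < 2 * (t.subtree w).card) :
    t.OnPathFromRoot v w ∨ t.OnPathFromRoot w v := by
  have : (t.subtree v ∩ t.subtree w).Nonempty := by
    rw [← Finset.card_pos]
    have h1 := Finset.card_union_add_card_inter (t.subtree v) (t.subtree w)
    have h2 := Finset.card_le_univ (t.subtree v ∪ t.subtree w)
    rw [Fintype.card_fin] at h2
    omega
  obtain ⟨u, hu⟩ := this
  rw [Finset.mem_inter, mem_subtree, mem_subtree] at hu
  obtain ⟨⟨i, rfl⟩, ⟨j, rfl⟩⟩ := hu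
  rcases le_total i j with h | h
  · exact .inr ⟨j - i, by rw [← Function.iterate_add_apply, Nat.sub_add_cancel h]⟩
  · exact .inl ⟨i - j, by rw [← Function.iterate_add_apply, Nat.sub_add_cancel h]⟩

/-- On the way down to a node whose subtree has more than half of the nodes the total distance
decreases. -/
theorem sum_dist_lt_of_onPathFromRoot {t : IncreasingTree n} {v c : Fin n}
    (hv : n < 2 * (t.subtree v).card) (h : t.OnPathFromRoot c v) (hne : c ≠ v) :
    ∑ u, t.graph.dist v u < ∑ u, t.graph.dist c u := by
  induction hm : v.val using Nat.strong_induction_on generalizing v with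
  | _ m ih =>
    rcases (t.onPathFromRoot_iff c v).1 h with h' | ⟨hpos, h'⟩
    · exact absurd h'.symm hne
    · have h1 := sum_dist_add_two_mul_card_subtree (t := t) hpos
      have h2 := Finset.card_le_card (t.onPathFromRoot_parent v).subtree_subset
      have h3 : ∑ u, t.graph.dist v u < ∑ u, t.graph.dist (t.parent v) u := by omega
      by_cases hc : c = t.parent v
      · rw [hc]; exact h3
      · exact h3.trans (ih _ (hm ▸ t.parent_lt hpos) (by omega) h' hc rfl)

/-- The subtree of the nearest centroid has more than half of the nodes: otherwise the parent would
be a centroid that is nearer to the root. -/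
theorem IsNearestCentroid.lt_card_subtree {t : IncreasingTree n} {c : Fin n}
    (hc : t.IsNearestCentroid c) : n < 2 * (t.subtree c).card := by
  have hn := c.pos
  rcases Nat.eq_zero_or_pos c.val with h | h
  · have : t.subtree c = Finset.univ := by
      ext u; simp [mem_subtree, t.onPathFromRoot_root c h u]
    rw [this, Finset.card_univ, Fintype.card_fin]
    omega
  · by_contra hlt
    have h1 := sum_dist_add_two_mul_card_subtree (t := t) h
    have hcen : t.IsCentroid (t.parent c) := fun w => by
      have := hc.1 w
      omega
    have h2 := hc.2 ⟨0, hn⟩ (t.parent c) rfl hcen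
    have h3 : t.graph.dist c ⟨0, hn⟩ = t.graph.dist (t.parent c) ⟨0, hn⟩ + 1 := by
      refine dist_of_notMem h fun h0 => ?_
      have := (mem_subtree.1 h0).le
      exact absurd this (not_le.2 h)
    rw [t.graph.dist_comm, h3, t.graph.dist_comm (u := ⟨0, hn⟩)] at h2
    omega

theorem exists_isNearestCentroid (hn : 0 < n) (t : IncreasingTree n) :
    ∃ c, t.IsNearestCentroid c := by
  classical
  have : Nonempty (Fin n) := ⟨⟨0, hn⟩⟩
  obtain ⟨c₀, -, h₀⟩ := Finset.exists_min_image Finset.univ (fun c => ∑ u, t.graph.dist c u)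
    Finset.univ_nonempty
  obtain ⟨c, hc, h⟩ := Finset.exists_min_image (Finset.univ.filter t.IsCentroid)
    (fun c => t.graph.dist ⟨0, hn⟩ c)
      ⟨c₀, Finset.mem_filter.2 ⟨Finset.mem_univ _, fun w => h₀ w (Finset.mem_univ w)⟩⟩
  refine ⟨c, (Finset.mem_filter.1 hc).2, fun r c' hr hc' => ?_⟩
  obtain rfl : r = ⟨0, hn⟩ := Fin.ext hr
  exact h c' (by simpa using hc')

theorem exists_onPathFromRoot_isNearestCentroid_iff (t : IncreasingTree n) (v : Fin n) :
    (∃ c, t.IsNearestCentroid c ∧ t.OnPathFromRoot v c) ↔ n < 2 * (t.subtree v).card := by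
  constructor
  · rintro ⟨c, hc, h⟩
    have := hc.lt_card_subtree
    have := Finset.card_le_card h.subtree_subset
    omega
  · intro hv
    obtain ⟨c, hc⟩ := t.exists_isNearestCentroid v.pos
    refine ⟨c, hc, ?_⟩
    rcases onPathFromRoot_or_of_lt_card_subtree hv hc.lt_card_subtree with h | h
    · exact h
    · by_cases hne : c = v
      · exact hne ▸ .refl t c
      · exact absurd (hc.1 v) (not_le.2 (sum_dist_lt_of_onPathFromRoot hv h hne))

end IncreasingTree

/-- A node is on the path from the root to the nearest centroid if and only if it has at least
`⌊n / 2⌋` descendants, that is, if and only if its subtree has more than `n / 2` nodes. -/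
theorem PlaneIncreasingTree.onCentroidPath_iff_lam {n : ℕ} (k : ℕ) (T : PlaneIncreasingTree n) :
    T.OnCentroidPath k ↔ T.Lam k (1 / 2) := by
  have hfloor : ⌊(1 / 2 : ℝ) * n⌋₊ = n / 2 := by
    rw [one_div, inv_mul_eq_div]
    exact_mod_cast Nat.floor_div_eq_div (K := ℝ) n 2
  have h : ∀ v : Fin n, (∃ c, T.tree.IsNearestCentroid c ∧ T.tree.OnPathFromRoot v c) ↔
      ⌊(1 / 2 : ℝ) * n⌋₊ ≤ (T.tree.descendants v).card := fun v => by
    rw [T.tree.exists_onPathFromRoot_isNearestCentroid_iff, IncreasingTree.card_subtree, hfloor]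
    omega
  simp only [OnCentroidPath, Lam, ← h, ← exists_and_left]

/-! ### Logarithmic estimates for quotients of rising factorials -/

theorem abs_log_sub_log_le {x y m : ℝ} (hm : 0 < m) (hx : m ≤ x) (hy : m ≤ y) :
    |Real.log x - Real.log y| ≤ |x - y| / m := by
  have key : ∀ x y : ℝ, m ≤ x → m ≤ y → Real.log x - Real.log y ≤ |x - y| / m := by
    intro x y hx hy
    have hx0 := hm.trans_le hx
    have hy0 := hm.trans_le hy
    rw [← Real.log_div hx0.ne' hy0.ne']
    calc Real.log (x / y) ≤ x / y - 1 := Real.log_le_sub_one_of_pos (div_pos hx0 hy0)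
      _ = (x - y) / y := by field_simp
      _ ≤ |x - y| / y := by gcongr; exact le_abs_self _
      _ ≤ |x - y| / m := by gcongr
  refine abs_le.2 ⟨?_, key x y hx hy⟩
  have := key y x hy hx
  rw [abs_sub_comm] at this
  linarith

theorem log_sub_log_mem {x y : ℝ} (hx : 0 < x) (hy : 0 < y) :
    (x - y) / x ≤ Real.log x - Real.log y ∧ Real.log x - Real.log y ≤ (x - y) / y := by
  have h1 := Real.log_le_sub_one_of_pos (div_pos hx hy)
  have h2 := Real.log_le_sub_one_of_pos (div_pos hy hx)
  rw [Real.log_div hx.ne' hy.ne'] at h1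
  rw [Real.log_div hy.ne' hx.ne'] at h2
  rw [sub_div, sub_div, div_self hx.ne', div_self hy.ne']
  constructor <;> linarith

theorem risingFactorial_add (x : ℝ) (m n : ℕ) :
    risingFactorial x (m + n) = risingFactorial x m * risingFactorial (x + m) n := by
  induction n with
  | zero => simp
  | succ n ih =>
    rw [← add_assoc, risingFactorial_succ, ih, risingFactorial_succ]
    push_cast
    ring

theorem risingFactorial_natCast (b n : ℕ) : risingFactorial b n = (b.ascFactorial n : ℝ) := by
  rw [risingFactorial, ← Nat.cast_ascFactorial]

/-- The quotient `α (α + 1) ⋯ (α + x - 1) / x!`, of the order of magnitude of `x ^ (α - 1)`. -/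
noncomputable def risingQuotient (α : ℝ) (x : ℕ) : ℝ := risingFactorial α x / x.factorial

theorem risingQuotient_pos {α : ℝ} (hα : 0 < α) (x : ℕ) : 0 < risingQuotient α x :=
  div_pos (risingFactorial_pos hα x) (by positivity)

theorem log_risingQuotient_succ {α : ℝ} (hα : 0 < α) (x : ℕ) :
    Real.log (risingQuotient α (x + 1)) =
      Real.log (risingQuotient α x) + (Real.log (α + x) - Real.log (x + 1)) := by
  have h : risingQuotient α (x + 1) = risingQuotient α x * ((α + x) / (x + 1)) := by
    rw [risingQuotient, risingQuotient, risingFactorial_succ, Nat.factorial_succ]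
    push_cast
    field_simp
  rw [h, Real.log_mul (risingQuotient_pos hα x).ne' (by positivity),
    Real.log_div (by positivity) (by positivity)]

/-- The logarithms of `risingQuotient α x` and of `x ^ (α - 1)` have the same increments up to
`O(1 / x ^ 2)`. -/
theorem abs_log_risingQuotient_step {α : ℝ} (hα : 0 < α) {x : ℝ} (hx : 0 < x) :
    |Real.log (α + x) - Real.log (x + 1) - (α - 1) * (Real.log (x + 1) - Real.log x)| ≤
      ((α - 1) ^ 2 + |α - 1|) / x ^ 2 := by
  have hax : 0 < α + x := by positivity
  have hx1 : 0 < x + 1 := by positivity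
  obtain ⟨h1, h2⟩ := log_sub_log_mem hax hx1
  obtain ⟨h3, h4⟩ := log_sub_log_mem hx1 hx
  -- both logarithms are compared with their common first-order term `(α - 1) / (x + 1)`
  have e1 : |Real.log (α + x) - Real.log (x + 1) - (α - 1) / (x + 1)| ≤ (α - 1) ^ 2 / x ^ 2 := by
    have e : (α - 1) / (x + 1) - (α + x - (x + 1)) / (α + x)
        = (α - 1) ^ 2 / ((x + 1) * (α + x)) := by field_simp; ring
    have e' : (α - 1) ^ 2 / ((x + 1) * (α + x)) ≤ (α - 1) ^ 2 / x ^ 2 := by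
      gcongr
      nlinarith
    have e'' : (α + x - (x + 1)) / (x + 1) = (α - 1) / (x + 1) := by ring
    have : 0 ≤ (α - 1) ^ 2 / x ^ 2 := by positivity
    rw [abs_le]
    constructor <;> linarith
  have e2 : |Real.log (x + 1) - Real.log x - 1 / (x + 1)| ≤ 1 / x ^ 2 := by
    have e : (x + 1 - x) / x - 1 / (x + 1) = 1 / (x * (x + 1)) := by field_simp; ring
    have e' : 1 / (x * (x + 1)) ≤ 1 / x ^ 2 := by
      gcongr
      nlinarith
    have e'' : (x + 1 - x) / (x + 1) = 1 / (x + 1) := by ring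
    have : 0 ≤ 1 / x ^ 2 := by positivity
    rw [abs_le]
    constructor <;> linarith
  calc _ = |(Real.log (α + x) - Real.log (x + 1) - (α - 1) / (x + 1)) -
        (α - 1) * (Real.log (x + 1) - Real.log x - 1 / (x + 1))| := by congr 1; ring
    _ ≤ (α - 1) ^ 2 / x ^ 2 + |α - 1| * (1 / x ^ 2) := by
        refine (abs_sub _ _).trans (add_le_add e1 ?_)
        rw [abs_mul]
        gcongr
    _ = _ := by ring

/-- The crude sum of the errors of the single steps suffices, as it is applied with `x` and `y`
of the same order of magnitude. -/
theorem abs_log_risingQuotient_sub {α : ℝ} (hα : 0 < α) {x y : ℕ} (hx : 0 < x) (hxy : x ≤ y) :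
    |Real.log (risingQuotient α x) - Real.log (risingQuotient α y) -
        (α - 1) * (Real.log x - Real.log y)| ≤
      (y - x) * (((α - 1) ^ 2 + |α - 1|) / (x : ℝ) ^ 2) := by
  have hx0 : (0 : ℝ) < x := by exact_mod_cast hx
  induction y, hxy using Nat.le_induction with
  | base => simp
  | succ y hy ih =>
    have hxy' : (x : ℝ) ≤ y := by exact_mod_cast hy
    have h := abs_log_risingQuotient_step hα (hx0.trans_le hxy')
    have h' : ((α - 1) ^ 2 + |α - 1|) / (y : ℝ) ^ 2 ≤
        ((α - 1) ^ 2 + |α - 1|) / (x : ℝ) ^ 2 := by gcongr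
    rw [log_risingQuotient_succ hα]
    push_cast
    rw [abs_le] at ih h ⊢
    constructor <;> linarith [h.1, h.2, ih.1, ih.2]

theorem abs_log_risingFactorial_sub {x y e m : ℝ} (hm : 0 < m) (hx : m ≤ x) (hy : m ≤ y) (b : ℕ)
    (h : ∀ i < b, |x + i - y| ≤ e) :
    |Real.log (risingFactorial x b) - b * Real.log y| ≤ b * (e / m) := by
  have hx0 := hm.trans_le hx
  induction b with
  | zero => simp
  | succ b ih =>
    have h1 := ih fun i hi => h i (hi.trans b.lt_succ_self)
    have hb : (0 : ℝ) ≤ b := by positivity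
    have hmx : m ≤ x + b := by linarith
    have h2 : |Real.log (x + b) - Real.log y| ≤ e / m :=
      (abs_log_sub_log_le hm hmx hy).trans (by gcongr; exact h b b.lt_succ_self)
    rw [risingFactorial_succ, Real.log_mul (risingFactorial_pos hx0 b).ne' (by positivity)]
    push_cast
    rw [abs_le] at h1 h2 ⊢
    constructor <;> linarith [h1.1, h1.2, h2.1, h2.2]

/-! ### The terms of the beta-binomial tail -/

/-- The constant in the comparison of the terms of the beta-binomial law with the beta density. -/
noncomputable def tailConst (α : ℝ) : ℝ :=
  16 * ((α - 1) ^ 2 + |α - 1|) + 6 * |α - 1| + 2 * α + 2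

theorem tailConst_pos {α : ℝ} (hα : 0 < α) : 0 < tailConst α := by
  unfold tailConst; positivity

/-- With `n = N + a + 2` and `x` within `O(a + 2)` of `n * (1 - t)`, the factor that multiplies the
product of consecutive integers in `betaBinomial_term` is close to `(1 - t) ^ (α - 1) / n ^ (a + 1)`
on the logarithmic scale. -/
theorem abs_log_tailFactor {α : ℝ} (hα : 0 < α) {a N x : ℕ} {n t : ℝ} (hn : n = N + a + 2)
    (hk : 2 * ((a : ℝ) + 2) ≤ n) (hxN : x ≤ N) (hx : n ≤ 4 * x) (ht1 : x ≤ n * (1 - t))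
    (ht2 : n * (1 - t) ≤ x + a + 2) :
    |Real.log (risingQuotient α x / risingQuotient α N / risingFactorial (α + N) (a + 1)) -
        ((α - 1) * Real.log (1 - t) - (a + 1) * Real.log n)| ≤
      tailConst α * (((a : ℝ) + 2) ^ 2 / n) := by
  have ha0 : (0 : ℝ) ≤ a := by positivity
  have hn0 : 0 < n := by linarith
  have hx0 : (0 : ℝ) < x := by linarith
  have hxN' : (x : ℝ) ≤ N := by exact_mod_cast hxN
  have hN : n / 2 ≤ N := by linarith
  have hxq : n / 4 ≤ x := by linarith
  have ht0 : 0 < 1 - t := by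
    by_contra h
    have := mul_nonpos_of_nonneg_of_nonpos hn0.le (not_lt.1 h)
    linarith
  have h1 : |Real.log (risingQuotient α x) - Real.log (risingQuotient α N) -
        (α - 1) * (Real.log x - Real.log N)| ≤ 16 * ((α - 1) ^ 2 + |α - 1|) / n := by
    refine (abs_log_risingQuotient_sub hα (by exact_mod_cast hx0) hxN).trans ?_
    calc ((N : ℝ) - x) * (((α - 1) ^ 2 + |α - 1|) / (x : ℝ) ^ 2)
        ≤ n * (((α - 1) ^ 2 + |α - 1|) / (n / 4) ^ 2) := by
          gcongr
          linarith
      _ = _ := by field_simp; ring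
  have h2 : |(α - 1) * (Real.log x - Real.log (n * (1 - t)))| ≤
      |α - 1| * (4 * ((a + 2) / n)) := by
    rw [abs_mul]
    gcongr
    refine (abs_log_sub_log_le (m := n / 4) (by positivity) hxq (hxq.trans ht1)).trans ?_
    rw [div_div_eq_mul_div, mul_comm, mul_div_assoc]
    gcongr
    rw [abs_le]
    constructor <;> linarith
  have h3 : |(α - 1) * (Real.log N - Real.log n)| ≤ |α - 1| * (2 * ((a + 2) / n)) := by
    rw [abs_mul]
    gcongr
    refine (abs_log_sub_log_le (m := n / 2) (by positivity) hN (by linarith)).trans ?_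
    rw [div_div_eq_mul_div, mul_comm, mul_div_assoc]
    gcongr
    rw [abs_le]
    constructor <;> linarith
  have h4 : |Real.log (risingFactorial (α + N) (a + 1)) - (a + 1 : ℕ) * Real.log n| ≤
      (a + 1 : ℕ) * ((α + (a + 2)) / (n / 2)) := by
    refine abs_log_risingFactorial_sub (by positivity) (by linarith) (by linarith) _ fun i hi => ?_
    have hi' : (i : ℝ) ≤ a := by exact_mod_cast Nat.lt_succ_iff.1 hi
    have : (0 : ℝ) ≤ i := by positivity
    rw [abs_le]
    constructor <;> linarith
  have hNpos : 0 < α + N := by linarith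
  have hrf := risingFactorial_pos hNpos (a + 1)
  have hsum : 16 * ((α - 1) ^ 2 + |α - 1|) / n + |α - 1| * (4 * ((a + 2) / n)) +
      |α - 1| * (2 * ((a + 2) / n)) + (a + 1 : ℕ) * ((α + (a + 2)) / (n / 2)) ≤
      tailConst α * (((a : ℝ) + 2) ^ 2 / n) := by
    have e : tailConst α * (((a : ℝ) + 2) ^ 2 / n) -
        (16 * ((α - 1) ^ 2 + |α - 1|) / n + |α - 1| * (4 * ((a + 2) / n)) +
        |α - 1| * (2 * ((a + 2) / n)) + (a + 1 : ℕ) * ((α + (a + 2)) / (n / 2)))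
      = (16 * ((α - 1) ^ 2 + |α - 1|) * ((a + 2) ^ 2 - 1) + 6 * |α - 1| * (a + 2) * (a + 1)
        + 2 * α * ((a + 2) ^ 2 - (a + 1)) + 2 * (a + 2)) / n := by
      unfold tailConst
      push_cast
      field_simp
      ring
    have e1 : 0 ≤ ((a : ℝ) + 2) ^ 2 - 1 := by nlinarith
    have e2 : 0 ≤ ((a : ℝ) + 2) ^ 2 - (a + 1) := by nlinarith
    rw [← sub_nonneg, e]
    positivity
  rw [Real.log_div (div_pos (risingQuotient_pos hα x) (risingQuotient_pos hα N)).ne' hrf.ne',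
    Real.log_div (risingQuotient_pos hα x).ne' (risingQuotient_pos hα N).ne']
  rw [Real.log_mul hn0.ne' ht0.ne'] at h2
  push_cast at h4 hsum
  refine le_trans ?_ hsum
  rw [abs_le] at h1 h2 h3 h4 ⊢
  constructor <;> linarith [h1.1, h1.2, h2.1, h2.2, h3.1, h3.2, h4.1, h4.2]

theorem tailFactor_mem {α : ℝ} (hα : 0 < α) {a N x : ℕ} {n t : ℝ} (hn : n = N + a + 2)
    (hk : 2 * ((a : ℝ) + 2) ≤ n) (hxN : x ≤ N) (hx : n ≤ 4 * x) (ht1 : x ≤ n * (1 - t))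
    (ht2 : n * (1 - t) ≤ x + a + 2) :
    Real.exp (-(tailConst α * (((a : ℝ) + 2) ^ 2 / n))) * ((1 - t) ^ (α - 1) / n ^ (a + 1)) ≤
        risingQuotient α x / risingQuotient α N / risingFactorial (α + N) (a + 1) ∧
      risingQuotient α x / risingQuotient α N / risingFactorial (α + N) (a + 1) ≤
        Real.exp (tailConst α * (((a : ℝ) + 2) ^ 2 / n)) * ((1 - t) ^ (α - 1) / n ^ (a + 1)) := by
  have h := abs_log_tailFactor hα hn hk hxN hx ht1 ht2
  have ha0 : (0 : ℝ) ≤ a := by positivity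
  have hn0 : 0 < n := by linarith
  have ht0 : 0 < 1 - t := by
    by_contra h
    have := mul_nonpos_of_nonneg_of_nonpos hn0.le (not_lt.1 h)
    linarith
  have hNpos : 0 < α + N := by positivity
  have hw : 0 < risingQuotient α x / risingQuotient α N / risingFactorial (α + N) (a + 1) :=
    div_pos (div_pos (risingQuotient_pos hα x) (risingQuotient_pos hα N))
      (risingFactorial_pos hNpos _)
  have hd : (1 - t) ^ (α - 1) / n ^ (a + 1) =
      Real.exp ((α - 1) * Real.log (1 - t) - (a + 1) * Real.log n) := by
    rw [Real.exp_sub, Real.rpow_def_of_pos ht0, mul_comm (Real.log _)]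
    congr 1
    rw [← Real.rpow_natCast, Real.rpow_def_of_pos hn0]
    push_cast
    ring_nf
  rw [hd, ← Real.exp_add, ← Real.exp_add, ← Real.le_log_iff_exp_le hw,
    ← Real.log_le_iff_le_exp hw]
  rw [abs_le] at h
  constructor <;> linarith [h.1, h.2]

/-- The probability `C(N, j) α^(N-j) b^(j) / (α + b)^(N)` (rising factorials, `b = a + 1`) of the
beta-binomial law, multiplied by the beta function `a! / α^(a+1)`. -/
theorem betaBinomial_term {α : ℝ} (hα : 0 < α) (a N j : ℕ) (hj : j ≤ N) :
    a.factorial / risingFactorial α (a + 1) *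
        ((N.choose j : ℝ) * risingFactorial α (N - j) * risingFactorial (a + 1 : ℕ) j /
          risingFactorial (α + (a + 1 : ℕ)) N) =
      ((j + 1).ascFactorial a : ℝ) *
        (risingQuotient α (N - j) / risingQuotient α N / risingFactorial (α + N) (a + 1)) := by
  have h1 : risingFactorial α (a + 1) * risingFactorial (α + (a + 1 : ℕ)) N =
      risingFactorial α N * risingFactorial (α + N) (a + 1) := by
    rw [← risingFactorial_add, ← risingFactorial_add, add_comm]
  have h2 : (a.factorial : ℝ) * ((a + 1).ascFactorial j : ℝ) =
      j.factorial * ((j + 1).ascFactorial a : ℝ) := by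
    exact_mod_cast (Nat.factorial_mul_ascFactorial a j).trans
      ((congrArg Nat.factorial (add_comm a j)).trans (Nat.factorial_mul_ascFactorial j a).symm)
  have h3 : (N.choose j : ℝ) = N.factorial / (j.factorial * (N - j).factorial) :=
    Nat.cast_choose ℝ hj
  have p1 := (risingFactorial_pos hα (a + 1)).ne'
  have p2 := (risingFactorial_pos (x := α + (a + 1 : ℕ)) (by positivity) N).ne'
  have p3 := (risingFactorial_pos hα N).ne'
  have p4 := (risingFactorial_pos (x := α + N) (by positivity) (a + 1)).ne'
  have q1 : (j.factorial : ℝ) ≠ 0 := by positivity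
  have q2 : ((N - j).factorial : ℝ) ≠ 0 := by positivity
  have q3 : (N.factorial : ℝ) ≠ 0 := by positivity
  calc _ = (a.factorial * ((a + 1).ascFactorial j : ℝ)) * (N.choose j : ℝ) *
        risingFactorial α (N - j) /
          (risingFactorial α (a + 1) * risingFactorial (α + (a + 1 : ℕ)) N) := by
        rw [risingFactorial_natCast]; field_simp
    _ = _ := by
        rw [h1, h2, h3, risingQuotient, risingQuotient]; field_simp

/-! ### Comparison of the beta-binomial tail with the beta integral -/

theorem sum_le_integral_of_le {f : ℝ → ℝ} {n s C : ℝ} (hn : 0 < n) (T : ℕ → ℝ) (M : ℕ)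
    (hf : ∀ j < M, IntervalIntegrable f MeasureTheory.volume ((j + s) / n) ((j + 1 + s) / n))
    (h : ∀ j < M, ∀ t ∈ Set.Icc ((j + s) / n) ((j + 1 + s) / n), T j * n ≤ C * f t) :
    ∑ j ∈ Finset.range M, T j ≤ C * ∫ t in (s / n)..((M + s) / n), f t := by
  have hsum := intervalIntegral.sum_integral_adjacent_intervals (f := f)
    (μ := MeasureTheory.volume) (a := fun j : ℕ => ((j : ℝ) + s) / n) (n := M)
    (fun j hj => by simpa using hf j hj)
  simp only [Nat.cast_zero, zero_add] at hsum
  rw [← hsum, Finset.mul_sum]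
  refine Finset.sum_le_sum fun j hj => ?_
  have hj := Finset.mem_range.1 hj
  push_cast
  have hle : ((j : ℝ) + s) / n ≤ (j + 1 + s) / n := by gcongr; linarith
  have := intervalIntegral.integral_mono_on hle (intervalIntegrable_const (c := T j * n))
    ((hf j hj).const_mul C) (h j hj)
  rw [intervalIntegral.integral_const, intervalIntegral.integral_const_mul, smul_eq_mul] at this
  refine le_trans (le_of_eq ?_) this
  field_simp
  ring

theorem integral_le_sum_of_le {f : ℝ → ℝ} {n s C : ℝ} (hn : 0 < n) (T : ℕ → ℝ) (M : ℕ)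
    (hf : ∀ j < M, IntervalIntegrable f MeasureTheory.volume ((j + s) / n) ((j + 1 + s) / n))
    (h : ∀ j < M, ∀ t ∈ Set.Icc ((j + s) / n) ((j + 1 + s) / n), C * f t ≤ T j * n) :
    C * ∫ t in (s / n)..((M + s) / n), f t ≤ ∑ j ∈ Finset.range M, T j := by
  have := sum_le_integral_of_le (C := -C) hn (fun j => -T j) M hf
    fun j hj t ht => by have := h j hj t ht; linarith
  rw [Finset.sum_neg_distrib] at this
  linarith

/-- The unnormalised beta density with parameters `a + 1` and `α`. -/
noncomputable def betaKernel (α : ℝ) (a : ℕ) (t : ℝ) : ℝ := t ^ a * (1 - t) ^ (α - 1)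

theorem continuousOn_betaKernel (α : ℝ) (a : ℕ) {s : Set ℝ} (hs : ∀ t ∈ s, t < 1) :
    ContinuousOn (betaKernel α a) s := by
  refine (continuousOn_pow a).mul (ContinuousOn.rpow_const (by fun_prop) fun t ht => .inl ?_)
  have := hs t ht
  linarith

theorem intervalIntegrable_betaKernel (α : ℝ) (a : ℕ) {x y : ℝ} (hx : x < 1) (hy : y < 1) :
    IntervalIntegrable (betaKernel α a) MeasureTheory.volume x y :=
  (continuousOn_betaKernel α a fun _ ht => ht.2.trans_lt (max_lt hx hy)).intervalIntegrable

theorem betaKernel_nonneg {α : ℝ} {a : ℕ} {t : ℝ} (h0 : 0 ≤ t) (h1 : t ≤ 1) :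
    0 ≤ betaKernel α a t :=
  mul_nonneg (pow_nonneg h0 a) (Real.rpow_nonneg (by linarith) _)

theorem integral_betaKernel_mono {α : ℝ} {a : ℕ} {x y x' y' : ℝ} (h0 : 0 ≤ x') (hx : x' ≤ x)
    (hxy : x ≤ y) (hy : y ≤ y') (h1 : y' < 1) :
    ∫ t in x..y, betaKernel α a t ≤ ∫ t in x'..y', betaKernel α a t := by
  refine intervalIntegral.integral_mono_interval hx hxy hy ?_
    (intervalIntegrable_betaKernel α a (by linarith) h1)
  refine (MeasureTheory.ae_restrict_iff' measurableSet_Ioc).2 (.of_forall fun t ht => ?_)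
  exact betaKernel_nonneg (h0.trans ht.1.le) (ht.2.trans h1.le)

theorem integral_betaKernel_pos (α : ℝ) (a : ℕ) {X : ℝ} (h0 : 0 < X) (h1 : X < 1) :
    0 < ∫ t in (0 : ℝ)..X, betaKernel α a t := by
  refine intervalIntegral.intervalIntegral_pos_of_pos_on
    (intervalIntegrable_betaKernel α a (by norm_num) h1) (fun t ht => ?_) h0
  exact mul_pos (pow_pos ht.1 a) (Real.rpow_pos_of_pos (by linarith [ht.2]) _)

theorem integral_betaKernel {α : ℝ} (hα : 0 < α) (a : ℕ) :
    ∫ t in (0 : ℝ)..1, betaKernel α a t = a.factorial / risingFactorial α (a + 1) := by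
  have h := Complex.betaIntegral_eval_nat_add_one_right (u := (α : ℂ)) (by simpa using hα) a
  rw [← Complex.betaIntegral_symm, Complex.betaIntegral] at h
  have hint : ∫ x : ℝ in (0 : ℝ)..1, (x : ℂ) ^ ((a : ℂ) + 1 - 1) * (1 - (x : ℂ)) ^ ((α : ℂ) - 1)
      = ((∫ t in (0 : ℝ)..1, betaKernel α a t : ℝ) : ℂ) := by
    rw [← intervalIntegral.integral_ofReal]
    refine intervalIntegral.integral_congr fun t ht => ?_
    rw [Set.uIcc_of_le zero_le_one] at ht
    have h1 : (0 : ℝ) ≤ 1 - t := by linarith [ht.2]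
    simp only [betaKernel, add_sub_cancel_right, Complex.cpow_natCast]
    rw [Complex.ofReal_mul, Complex.ofReal_pow, Complex.ofReal_cpow h1]
    push_cast
    rfl
  have hr : ∀ m : ℕ, ∏ j ∈ Finset.range m, ((α : ℂ) + j) = (risingFactorial α m : ℂ) := by
    intro m
    induction m with
    | zero => simp
    | succ m ih => rw [Finset.prod_range_succ, ih, risingFactorial_succ]; push_cast; rfl
  rw [hint, hr] at h
  exact_mod_cast h

/-- Cutting off a small part of the range of integration, by the substitution `t = l u`. -/
theorem le_integral_betaKernel_mul (α : ℝ) (a : ℕ) {X l : ℝ} (hX0 : 0 ≤ X) (hX : X ≤ 1 / 2)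
    (hl0 : 0 ≤ l) (hl1 : l ≤ 1) (hl : 2 * |α - 1| * (1 - l) ≤ 1) :
    (1 - (a + 1) * (1 - l)) * (1 - 2 * |α - 1| * (1 - l)) * ∫ t in (0 : ℝ)..X, betaKernel α a t ≤
        ∫ t in (0 : ℝ)..(l * X), betaKernel α a t := by
  have hI : 0 ≤ ∫ t in (0 : ℝ)..X, betaKernel α a t :=
    intervalIntegral.integral_nonneg hX0 fun t ht => betaKernel_nonneg ht.1 (by linarith [ht.2])
  have hbern : 1 - (a + 1) * (1 - l) ≤ l ^ (a + 1) := by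
    have := one_add_mul_le_pow (a := l - 1) (by linarith) (a + 1)
    push_cast at this
    rw [add_sub_cancel] at this
    linarith
  have hexp : 1 - 2 * |α - 1| * (1 - l) ≤ Real.exp (-(2 * |α - 1| * (1 - l))) := by
    linarith [Real.add_one_le_exp (-(2 * |α - 1| * (1 - l)))]
  have hpt : ∀ u ∈ Set.Icc 0 X, l ^ a * Real.exp (-(2 * |α - 1| * (1 - l))) * betaKernel α a u ≤
      betaKernel α a (l * u) := by
    intro u hu
    have hu1 : 1 / 2 ≤ 1 - u := by linarith [hu.2]
    have hlu : l * u ≤ u := mul_le_of_le_one_left hu.1 hl1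
    have hrp : Real.exp (-(2 * |α - 1| * (1 - l))) * (1 - u) ^ (α - 1) ≤
        (1 - l * u) ^ (α - 1) := by
      rw [Real.rpow_def_of_pos (by linarith), Real.rpow_def_of_pos (by linarith), ← Real.exp_add,
        Real.exp_le_exp]
      have h1 := abs_log_sub_log_le (m := 1 / 2) (by norm_num) hu1 (hu1.trans (by linarith) :
        1 / 2 ≤ 1 - l * u)
      have h2 : |1 - u - (1 - l * u)| ≤ 1 - l := by
        have e : 1 - u - (1 - l * u) = -((1 - l) * u) := by ring
        have h3 : 0 ≤ (1 - l) * u := mul_nonneg (by linarith) hu.1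
        rw [e, abs_neg, abs_of_nonneg h3]
        exact mul_le_of_le_one_right (by linarith) (by linarith [hu.2])
      have h4 : (Real.log (1 - u) - Real.log (1 - l * u)) * (α - 1) ≤
          2 * |α - 1| * (1 - l) := by
        refine (le_abs_self _).trans ?_
        rw [abs_mul]
        calc _ ≤ (1 - l) / (1 / 2) * |α - 1| := by
              gcongr
              exact h1.trans (by gcongr)
          _ = _ := by ring
      linarith
    calc _ = (l ^ a * u ^ a) * (Real.exp (-(2 * |α - 1| * (1 - l))) * (1 - u) ^ (α - 1)) := by
          rw [betaKernel]; ring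
      _ ≤ (l ^ a * u ^ a) * (1 - l * u) ^ (α - 1) := by
          gcongr
          exact mul_nonneg (pow_nonneg hl0 a) (pow_nonneg hu.1 a)
      _ = _ := by rw [betaKernel, mul_pow]
  have hmono : l ^ a * Real.exp (-(2 * |α - 1| * (1 - l))) * ∫ t in (0 : ℝ)..X, betaKernel α a t ≤
      ∫ u in (0 : ℝ)..X, betaKernel α a (l * u) := by
    rw [← intervalIntegral.integral_const_mul]
    refine intervalIntegral.integral_mono_on hX0
      ((intervalIntegrable_betaKernel α a (by norm_num) (by linarith)).const_mul _) ?_ hpt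
    refine ContinuousOn.intervalIntegrable ?_
    refine (continuousOn_betaKernel α a (s := Set.Iio 1) fun _ h => h).comp (by fun_prop) ?_
    intro u hu
    rw [Set.uIcc_of_le hX0] at hu
    have : l * u ≤ u := mul_le_of_le_one_left hu.1 hl1
    exact Set.mem_Iio.2 (by linarith [hu.2])
  have hsub := intervalIntegral.mul_integral_comp_mul_left (f := betaKernel α a) (c := l)
    (a := 0) (b := X)
  rw [mul_zero] at hsub
  rw [← hsub]
  calc _ ≤ l ^ (a + 1) * Real.exp (-(2 * |α - 1| * (1 - l))) *
        ∫ t in (0 : ℝ)..X, betaKernel α a t := by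
        refine mul_le_mul_of_nonneg_right ?_ hI
        exact mul_le_mul hbern hexp (by linarith) (by positivity)
    _ = l * (l ^ a * Real.exp (-(2 * |α - 1| * (1 - l))) *
        ∫ t in (0 : ℝ)..X, betaKernel α a t) := by ring
    _ ≤ _ := by gcongr

/-- The tail of the beta-binomial law with parameters `N`, `α`, `a + 1`, multiplied by the beta
function: the sum of the terms of `betaBinomial_term` for which `N - j` is at least `s`. -/
noncomputable def tailSum (α : ℝ) (a N s : ℕ) : ℝ :=
  ∑ j ∈ Finset.range (N - s + 1), ((j + 1).ascFactorial a : ℝ) *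
    (risingQuotient α (N - j) / risingQuotient α N / risingFactorial (α + N) (a + 1))

theorem natCast_sub_of_lt_sub_add_one {N s j : ℕ} (hsN : s ≤ N) (hj : j < N - s + 1) :
    ((N - j : ℕ) : ℝ) = N - j ∧ (j : ℝ) + s ≤ N := by
  refine ⟨by push_cast [(by omega : j ≤ N)]; ring, ?_⟩
  exact_mod_cast (by omega : j + s ≤ N)

/-- The term with index `j` is compared with the integral over `[(j + a) / n, (j + a + 1) / n]`,
where `t * n` is at least the last factor of `(j + 1) ⋯ (j + a)`. -/
theorem tailSum_le {α : ℝ} (hα : 0 < α) {a N s : ℕ} {n : ℝ} (hn : n = N + a + 2)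
    (hk : 2 * ((a : ℝ) + 2) ≤ n) (hsN : s ≤ N) (hs : n ≤ 4 * s) :
    tailSum α a N s ≤ Real.exp (tailConst α * (((a : ℝ) + 2) ^ 2 / n)) *
      ∫ t in (a / n)..(((N - s + 1 : ℕ) + a) / n), betaKernel α a t := by
  have ha0 : (0 : ℝ) ≤ a := by positivity
  have hn0 : 0 < n := by rw [hn]; positivity
  have hs0 : (0 : ℝ) < s := by linarith
  refine sum_le_integral_of_le hn0 _ _ (fun j hjM => ?_) fun j hjM t ht => ?_
  · obtain ⟨h1, h2⟩ := natCast_sub_of_lt_sub_add_one hsN hjM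
    refine intervalIntegrable_betaKernel α a ?_ ?_ <;> rw [div_lt_one hn0] <;> linarith
  · obtain ⟨h1, h2⟩ := natCast_sub_of_lt_sub_add_one hsN hjM
    have ht1 := (div_le_iff₀ hn0).1 ht.1
    have ht2 := (le_div_iff₀ hn0).1 ht.2
    have hw := (tailFactor_mem hα hn hk (Nat.sub_le N j) (by rw [h1]; linarith) (t := t)
      (by rw [h1]; linarith) (by rw [h1]; linarith)).2
    have ht0 : 0 ≤ t := le_trans (by positivity) ht.1
    have ht1' : 0 ≤ 1 - t := sub_nonneg.2 (le_of_mul_le_mul_right (by linarith) hn0)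
    have hasc : ((j + 1).ascFactorial a : ℝ) ≤ (t * n) ^ a := by
      calc ((j + 1).ascFactorial a : ℝ) ≤ ((j : ℝ) + a) ^ a := by
            exact_mod_cast Nat.ascFactorial_le_pow_add j a
        _ ≤ _ := by gcongr
    have hrp := Real.rpow_nonneg ht1' (α - 1)
    calc _ ≤ (t * n) ^ a * (Real.exp (tailConst α * (((a : ℝ) + 2) ^ 2 / n)) *
          ((1 - t) ^ (α - 1) / n ^ (a + 1))) * n := by
          refine mul_le_mul_of_nonneg_right ?_ hn0.le
          exact (mul_le_mul_of_nonneg_left hw (by positivity)).trans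
            (mul_le_mul_of_nonneg_right hasc (by positivity))
      _ = _ := by rw [betaKernel, mul_pow]; field_simp; ring

/-- The term with index `j` is compared with the integral over `[j / n, (j + 1) / n]`, where `t * n`
is at most the first factor of `(j + 1) ⋯ (j + a)`. -/
theorem le_tailSum {α : ℝ} (hα : 0 < α) {a N s : ℕ} {n : ℝ} (hn : n = N + a + 2)
    (hk : 2 * ((a : ℝ) + 2) ≤ n) (hsN : s ≤ N) (hs : n ≤ 4 * s) :
    Real.exp (-(tailConst α * (((a : ℝ) + 2) ^ 2 / n))) *
      ∫ t in (0 / n)..(((N - s + 1 : ℕ) + 0) / n), betaKernel α a t ≤ tailSum α a N s := by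
  have ha0 : (0 : ℝ) ≤ a := by positivity
  have hn0 : 0 < n := by rw [hn]; positivity
  have hs0 : (0 : ℝ) < s := by linarith
  refine integral_le_sum_of_le hn0 _ _ (fun j hjM => ?_) fun j hjM t ht => ?_
  · obtain ⟨h1, h2⟩ := natCast_sub_of_lt_sub_add_one hsN hjM
    refine intervalIntegrable_betaKernel α a ?_ ?_ <;> rw [div_lt_one hn0] <;> linarith
  · obtain ⟨h1, h2⟩ := natCast_sub_of_lt_sub_add_one hsN hjM
    have ht1 := (div_le_iff₀ hn0).1 ht.1
    have ht2 := (le_div_iff₀ hn0).1 ht.2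
    have hw := (tailFactor_mem hα hn hk (Nat.sub_le N j) (by rw [h1]; linarith) (t := t)
      (by rw [h1]; linarith) (by rw [h1]; linarith)).1
    have ht0 : 0 ≤ t := le_trans (by positivity) ht.1
    have ht1' : 0 ≤ 1 - t := sub_nonneg.2 (le_of_mul_le_mul_right (by linarith) hn0)
    have hasc : (t * n) ^ a ≤ ((j + 1).ascFactorial a : ℝ) := by
      calc (t * n) ^ a ≤ ((j : ℝ) + 1) ^ a := by
            refine pow_le_pow_left₀ (by positivity) (by linarith) _
        _ ≤ _ := by exact_mod_cast Nat.pow_succ_le_ascFactorial (j + 1) a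
    have hrp := Real.rpow_nonneg ht1' (α - 1)
    calc _ = (t * n) ^ a *
          (Real.exp (-(tailConst α * (((a : ℝ) + 2) ^ 2 / n))) *
            ((1 - t) ^ (α - 1) / n ^ (a + 1))) * n := by
          rw [betaKernel, mul_pow]; field_simp; ring
      _ ≤ _ := by
          refine mul_le_mul_of_nonneg_right ?_ hn0.le
          exact mul_le_mul hasc hw (by positivity) (by positivity)

/-- Shortening the range of integration by `(a + 1) / n` costs a factor `1 - O((a + 2) ^ 2 / n)`. -/
theorem le_integral_betaKernel_sub {α δ σ n : ℝ} {a : ℕ} (hδ : 0 < δ) (hn0 : 0 < n)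
    (hσ : 1 / 2 ≤ σ) (hσδ : σ ≤ 1 - δ) (h1 : ((a : ℝ) + 2) ^ 2 / n / δ ≤ 1)
    (h2 : 2 * |α - 1| * (((a : ℝ) + 2) ^ 2 / n / δ) ≤ 1) :
    0 ≤ 1 - σ - (a + 1) / n ∧
    (1 - ((a : ℝ) + 2) ^ 2 / n / δ) * (1 - 2 * |α - 1| * (((a : ℝ) + 2) ^ 2 / n / δ)) *
        ∫ t in (0 : ℝ)..(1 - σ), betaKernel α a t ≤
      ∫ t in (0 : ℝ)..(1 - σ - (a + 1) / n), betaKernel α a t := by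
  have ha0 : (0 : ℝ) ≤ a := by positivity
  have hσ1 : 0 < 1 - σ := by linarith
  obtain ⟨e, he⟩ : ∃ e, e = ((a : ℝ) + 1) / (n * (1 - σ)) := ⟨_, rfl⟩
  obtain ⟨q, hq⟩ : ∃ q, q = ((a : ℝ) + 2) ^ 2 / n / δ := ⟨_, rfl⟩
  rw [← hq] at h1 h2 ⊢
  have hI : 0 ≤ ∫ t in (0 : ℝ)..(1 - σ), betaKernel α a t :=
    (integral_betaKernel_pos α a hσ1 (by linarith)).le
  have he0 : 0 ≤ e := by rw [he]; positivity
  have he1 : ((a : ℝ) + 1) * e ≤ q := by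
    rw [he, hq]
    calc _ ≤ ((a : ℝ) + 1) * ((a + 1) / (n * δ)) := by gcongr; linarith
      _ = (a + 1) ^ 2 / n / δ := by field_simp
      _ ≤ (a + 2) ^ 2 / n / δ := by gcongr; linarith
  have he2 : e ≤ q := (le_mul_of_one_le_left he0 (by linarith)).trans he1
  have hd : 2 * |α - 1| * e ≤ 2 * |α - 1| * q := by gcongr
  have h := le_integral_betaKernel_mul α a (X := 1 - σ) (l := 1 - e)
    hσ1.le (by linarith) (by linarith) (by linarith) (by rw [sub_sub_cancel]; linarith)
  have hend : (1 - e) * (1 - σ) = 1 - σ - (a + 1) / n := by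
    rw [he]
    field_simp
  rw [sub_sub_cancel, hend] at h
  refine ⟨hend ▸ mul_nonneg (by linarith) hσ1.le, le_trans ?_ h⟩
  refine mul_le_mul_of_nonneg_right ?_ hI
  exact mul_le_mul (by linarith) (by linarith) (by linarith) (by linarith)

/-- The tail sum agrees with the incomplete beta integral up to a relative error of order
`(a + 2) ^ 2 / n`. -/
theorem exists_abs_tailSum_sub_le {α δ : ℝ} (hα : 0 < α) (hδ : 0 < δ) :
    ∃ K : ℝ, 0 < K ∧ ∀ (a N s : ℕ) (n σ : ℝ), n = N + a + 2 → 1 / 2 ≤ σ → σ ≤ 1 - δ →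
      s ≤ σ * n → σ * n < s + 1 → K * (((a : ℝ) + 2) ^ 2 / n) ≤ 1 →
      s ≤ N ∧ |tailSum α a N s - ∫ t in (0 : ℝ)..(1 - σ), betaKernel α a t| ≤
          K * (((a : ℝ) + 2) ^ 2 / n) * ∫ t in (0 : ℝ)..(1 - σ), betaKernel α a t := by
  have hκ := tailConst_pos hα
  refine ⟨2 * tailConst α + (1 + 2 * |α - 1|) / δ + 4, by positivity, ?_⟩
  intro a N s n σ hn hσ hσδ hs1 hs2 hK
  have ha0 : (0 : ℝ) ≤ a := by positivity
  have hn0 : 0 < n := by rw [hn]; positivity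
  obtain ⟨r, hr⟩ : ∃ r, r = ((a : ℝ) + 2) ^ 2 / n := ⟨_, rfl⟩
  obtain ⟨x, hx⟩ : ∃ x, x = tailConst α * r := ⟨_, rfl⟩
  obtain ⟨y, hy⟩ : ∃ y, y = r / δ := ⟨_, rfl⟩
  obtain ⟨z, hz⟩ : ∃ z, z = 2 * |α - 1| * y := ⟨_, rfl⟩
  obtain ⟨I, hI⟩ : ∃ I, I = ∫ t in (0 : ℝ)..(1 - σ), betaKernel α a t := ⟨_, rfl⟩
  have hI0 : 0 < I := hI ▸ integral_betaKernel_pos α a (by linarith) (by linarith)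
  have hr0 : 0 < r := by rw [hr]; positivity
  have hx0 : 0 ≤ x := by rw [hx]; positivity
  have hy0 : 0 ≤ y := by rw [hy]; positivity
  have hz0 : 0 ≤ z := by rw [hz]; positivity
  rw [← hr, ← hI]
  rw [← hr] at hK
  have hKr : (2 * tailConst α + (1 + 2 * |α - 1|) / δ + 4) * r = 2 * x + y + z + 4 * r := by
    rw [hz, hx, hy]; ring
  rw [hKr] at hK ⊢
  have hr4 : 4 * ((a : ℝ) + 2) ^ 2 ≤ n := by
    have : r ≤ 1 / 4 := by linarith
    rw [hr, div_le_iff₀ hn0] at this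
    linarith
  have hrδ : ((a : ℝ) + 2) ^ 2 ≤ δ * n := by
    have h : y ≤ 1 := by linarith
    rwa [hy, div_le_one hδ, hr, div_le_iff₀ hn0] at h
  have hsq : 2 * ((a : ℝ) + 2) ≤ ((a : ℝ) + 2) ^ 2 := by
    rw [sq]
    gcongr
    linarith
  have hσn : 1 / 2 * n ≤ σ * n := by gcongr
  have hs4 : n ≤ 4 * s := by linarith
  have hsN : s ≤ N := by
    have h1 : σ * n ≤ (1 - δ) * n := by gcongr
    have : (s : ℝ) ≤ N := by linarith
    exact_mod_cast this
  refine ⟨hsN, ?_⟩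
  have hMcast : ((N - s + 1 : ℕ) : ℝ) = N - s + 1 := by push_cast [hsN]; ring
  have hupper : tailSum α a N s ≤ Real.exp x * I := by
    rw [hx, hr, hI]
    refine (tailSum_le hα hn (by linarith) hsN hs4).trans ?_
    refine mul_le_mul_of_nonneg_left ?_ (Real.exp_nonneg _)
    refine integral_betaKernel_mono le_rfl (by positivity) (by gcongr; linarith [hMcast])
      ?_ (by linarith)
    rw [div_le_iff₀ hn0, hMcast]
    linarith
  have hlower : Real.exp (-x) * ((1 - y) * (1 - z) * I) ≤ tailSum α a N s := by
    obtain ⟨h1, h2⟩ := le_integral_betaKernel_sub (α := α) (a := a) hδ hn0 hσ hσδ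
      (by rw [← hr, ← hy]; linarith) (by rw [← hr, ← hy, ← hz]; linarith)
    rw [← hr, ← hy, ← hz, ← hI] at h2
    rw [hx, hr]
    refine le_trans ?_ (le_tailSum hα hn (by linarith) hsN hs4)
    refine mul_le_mul_of_nonneg_left (h2.trans ?_) (Real.exp_nonneg _)
    rw [zero_div, add_zero, hMcast]
    refine integral_betaKernel_mono le_rfl le_rfl h1 ?_ ?_
    · rw [le_div_iff₀ hn0, sub_mul, div_mul_cancel₀ _ hn0.ne']
      linarith
    · rw [div_lt_one hn0]
      linarith
  have hexp1 : 1 - x ≤ Real.exp (-x) := by linarith [Real.add_one_le_exp (-x)]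
  have hexp2 : Real.exp x ≤ 1 + 2 * x := by
    -- `exp x ≤ 1 / (1 - x) ≤ 1 + 2 x` for `0 ≤ x ≤ 1 / 2`
    have h1 : Real.exp x * (1 - x) ≤ 1 := by
      calc _ ≤ Real.exp x * Real.exp (-x) := by gcongr
        _ = 1 := by rw [← Real.exp_add, add_neg_cancel, Real.exp_zero]
    have h2 : 1 ≤ (1 + 2 * x) * (1 - x) := by nlinarith
    exact le_of_mul_le_mul_right (h1.trans h2) (by linarith)
  have hprod : 1 - (x + y + z) ≤ Real.exp (-x) * ((1 - y) * (1 - z)) := by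
    have h1 : 1 - (y + z) ≤ (1 - y) * (1 - z) := by nlinarith [mul_nonneg hy0 hz0]
    calc 1 - (x + y + z) ≤ (1 - x) * (1 - (y + z)) := by
          nlinarith [mul_nonneg hx0 (add_nonneg hy0 hz0)]
      _ ≤ _ := mul_le_mul hexp1 h1 (by linarith) (Real.exp_nonneg _)
  have hup' : Real.exp x * I ≤ (1 + 2 * x) * I := by gcongr
  have hlow' : (1 - (x + y + z)) * I ≤ Real.exp (-x) * ((1 - y) * (1 - z) * I) := by
    rw [← mul_assoc]
    gcongr
  have p1 := mul_nonneg hx0 hI0.le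
  have p2 := mul_nonneg hy0 hI0.le
  have p3 := mul_nonneg hz0 hI0.le
  have p4 := mul_nonneg hr0.le hI0.le
  rw [abs_le]
  constructor <;> linarith

/-! ### The probability of the event `Λ_k(σ)` -/

theorem sum_antidiagonal_eq_tailSum {α : ℝ} (hα : 0 < α) (a : ℕ) {N s : ℕ} (hs : s ≤ N) :
    (∑ ij ∈ Finset.HasAntidiagonal.antidiagonal N, (N.choose ij.1 : ℝ) *
        (risingFactorial α ij.1 * risingFactorial (a + 1 : ℕ) ij.2 * if s ≤ ij.1 then 1 else 0)) /
        risingFactorial (α + (a + 1 : ℕ)) N =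
      tailSum α a N s / (a.factorial / risingFactorial α (a + 1)) := by
  have hβ : 0 < (a.factorial : ℝ) / risingFactorial α (a + 1) :=
    div_pos (by positivity) (risingFactorial_pos hα _)
  rw [eq_div_iff hβ.ne', mul_comm, ← Finset.Nat.sum_antidiagonal_swap,
    Finset.Nat.sum_antidiagonal_eq_sum_range_succ_mk, tailSum, Finset.sum_div, Finset.mul_sum]
  have hsub : Finset.range (N - s + 1) ⊆ Finset.range N.succ :=
    Finset.range_subset_range.2 (by omega)
  rw [← Finset.sum_subset hsub]
  · refine Finset.sum_congr rfl fun j hj => ?_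
    have hj := Finset.mem_range.1 hj
    have hjN : j ≤ N := by omega
    have hsj : s ≤ N - j := by omega
    rw [← betaBinomial_term hα a N j hjN]
    simp only [Prod.swap_prod_mk, hsj, if_true, mul_one, Nat.choose_symm hjN]
    ring
  · intro j hj hj'
    have hj := Finset.mem_range.1 hj
    have hj' : ¬ j < N - s + 1 := fun h => hj' (Finset.mem_range.2 h)
    have hsj : ¬ s ≤ N - j := by omega
    simp [hsj]

/-- The exact probability of `Λ_k(σ)` for `k = a + 2` and trees of size `k + N`. -/
theorem treeProb_lam_eq {φ : ℕ → ℝ} {c α σ : ℝ} (hc : 0 < c) (hα : 0 < α)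
    (hy : PowerSeries.derivative ℝ (treeEGF φ) = oneSubPow c α) (a N : ℕ)
    (hs : ⌊σ * ((a + 1 + 1 + N : ℕ) : ℝ)⌋₊ ≤ N) :
    treeProb φ (a + 1 + 1 + N) (PlaneIncreasingTree.Lam (a + 2) σ) =
      tailSum α a N ⌊σ * ((a + 1 + 1 + N : ℕ) : ℝ)⌋₊ /
        (a.factorial / risingFactorial α (a + 1)) := by
  classical
  obtain ⟨s, hsdef⟩ : ∃ s, s = ⌊σ * ((a + 1 + 1 + N : ℕ) : ℝ)⌋₊ := ⟨_, rfl⟩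
  rw [← hsdef] at hs ⊢
  have hv : a + 1 < a + 1 + 1 + N := by omega
  have hE : PlaneIncreasingTree.Lam (n := a + 1 + 1 + N) (a + 2) σ =
      fun T => s ≤ (T.tree.descendants ⟨a + 1, hv⟩).card := by
    funext T
    refine propext ⟨?_, fun h => ⟨⟨a + 1, hv⟩, rfl, hsdef ▸ h⟩⟩
    rintro ⟨v, hvk, h⟩
    obtain rfl : v = ⟨a + 1, hv⟩ := Fin.ext (by simpa using hvk)
    exact hsdef ▸ h
  have htot : totalWeight φ (a + 1 + 1 + N) =
      c ^ (a + 1) * risingFactorial α (a + 1) * c ^ N * risingFactorial (α + (a + 1 : ℕ)) N := by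
    rw [totalWeight_eq_sum_degreeWeight, IncreasingTree.factorial_mul_eq_growthWeight hy,
      show a + 1 + 1 + N = a + 1 + N + 1 by ring, IncreasingTree.sum_growthWeight,
      risingFactorial_add]
    ring
  have hnum := IncreasingTree.sum_degreeWeight_descendants c α (a + 1) N ⟨a + 1, hv⟩ rfl
    fun m => if s ≤ m then 1 else 0
  rw [hE, treeProb_eq_sum_degreeWeight φ _ fun t => s ≤ (t.descendants ⟨a + 1, hv⟩).card,
    IncreasingTree.factorial_mul_eq_growthWeight hy, htot, ← sum_antidiagonal_eq_tailSum hα a hs]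
  simp_rw [mul_comm (ite _ _ _) (IncreasingTree.degreeWeight _ _)]
  have hpos := risingFactorial_pos hα (a + 1)
  refine Eq.trans (congrArg (· / _) ?_) (mul_div_mul_left _ _ (by positivity :
    c ^ (a + 1) * risingFactorial α (a + 1) * c ^ N ≠ 0))
  convert hnum

theorem regIncBeta_eq {α : ℝ} (hα : 0 < α) (a : ℕ) (X : ℝ) :
    regIncBeta X (((a + 2 : ℕ) : ℝ) - 1) α =
      (∫ t in (0 : ℝ)..X, betaKernel α a t) / (a.factorial / risingFactorial α (a + 1)) := by
  have h : ∀ t : ℝ, t ^ (((a + 2 : ℕ) : ℝ) - 1 - 1) * (1 - t) ^ (α - 1) = betaKernel α a t := by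
    intro t
    rw [betaKernel, show ((a + 2 : ℕ) : ℝ) - 1 - 1 = (a : ℕ) by push_cast; ring, Real.rpow_natCast]
  simp only [regIncBeta, h, integral_betaKernel hα]

/-- The error bound with explicit ranges of `n` and `k`: the only requirement on their size is that
`K * k ^ 2 / n` is at most `1`. -/
theorem exists_abs_treeProb_lam_sub_le {φ : ℕ → ℝ} {c α δ : ℝ} (hc : 0 < c) (hα : 0 < α)
    (hδ : 0 < δ) (hy : PowerSeries.derivative ℝ (treeEGF φ) = oneSubPow c α) :
    ∃ K : ℝ, 0 < K ∧ ∀ (n k : ℕ) (σ : ℝ), 1 / 2 ≤ σ → σ ≤ 1 - δ → 1 < k → k ≤ n →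
      K * ((k : ℝ) ^ 2 / n) ≤ 1 → 0 < regIncBeta (1 - σ) ((k : ℝ) - 1) α ∧
      |treeProb φ n (PlaneIncreasingTree.Lam k σ) - regIncBeta (1 - σ) ((k : ℝ) - 1) α| ≤
        K * ((k : ℝ) ^ 2 / n) * regIncBeta (1 - σ) ((k : ℝ) - 1) α := by
  obtain ⟨K, hK, h⟩ := exists_abs_tailSum_sub_le hα hδ
  refine ⟨K, hK, fun n k σ hσ hσδ hk hkn hKn => ?_⟩
  obtain ⟨a, rfl⟩ := Nat.exists_eq_add_of_le' hk
  obtain ⟨N, rfl⟩ := Nat.exists_eq_add_of_le hkn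
  rw [regIncBeta_eq hα]
  have hβ : 0 < (a.factorial : ℝ) / risingFactorial α (a + 1) :=
    div_pos (by positivity) (risingFactorial_pos hα _)
  have hcast : ((a + 2 : ℕ) : ℝ) = a + 2 := by push_cast; ring
  obtain ⟨h1, h2⟩ := h a N ⌊σ * ((a + 1 + 1 + N : ℕ) : ℝ)⌋₊ ((a + 1 + 1 + N : ℕ) : ℝ) σ
    (by push_cast; ring) hσ hσδ (Nat.floor_le (by positivity)) (Nat.lt_floor_add_one _)
    (hcast ▸ hKn)
  refine ⟨div_pos (integral_betaKernel_pos α a (by linarith) (by linarith)) hβ, ?_⟩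
  have hP := treeProb_lam_eq hc hα hy a N h1
  have e : K * (((a + 2 : ℕ) : ℝ) ^ 2 / ((a + 1 + 1 + N : ℕ) : ℝ)) =
    K * (((a : ℝ) + 2) ^ 2 / ((a + 1 + 1 + N : ℕ) : ℝ)) := by rw [hcast]
  change |treeProb φ (a + 1 + 1 + N) (PlaneIncreasingTree.Lam (a + 2) σ) - _| ≤
    K * (((a + 2 : ℕ) : ℝ) ^ 2 / ((a + 1 + 1 + N : ℕ) : ℝ)) * _
  rw [e, hP, ← sub_div, abs_div, abs_of_pos hβ, ← mul_div_assoc]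
  gcongr

theorem tendsto_sq_div_sqrt {k : ℕ → ℕ}
    (hk : (fun n => (k n : ℝ)) =o[atTop] (fun n : ℕ => (n : ℝ) ^ (1 / 4 : ℝ))) :
    Tendsto (fun n : ℕ => (k n : ℝ) ^ 2 / √(n : ℝ)) atTop (nhds 0) := by
  have h := (hk.pow two_pos).tendsto_div_nhds_zero
  refine h.congr fun n => ?_
  rw [Real.sqrt_eq_rpow, ← Real.rpow_natCast ((n : ℝ) ^ (1 / 4 : ℝ)),
    ← Real.rpow_mul (by positivity)]
  norm_num

theorem eventually_treeProb_lam {φ : ℕ → ℝ} {c α δ : ℝ} (hc : 0 < c) (hα : 0 < α)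
    (hδ : 0 < δ) (hy : PowerSeries.derivative ℝ (treeEGF φ) = oneSubPow c α) :
    ∃ C : ℝ, ∀ k : ℕ → ℕ,
      (fun n => (k n : ℝ)) =o[atTop] (fun n : ℕ => (n : ℝ) ^ (1 / 4 : ℝ)) →
      ∀ᶠ n : ℕ in atTop, ∀ σ : ℝ, 1 / 2 ≤ σ → σ ≤ 1 - δ → 1 < k n →
        ∃ ε : ℝ, |ε| ≤ C * ((k n : ℝ) ^ 2 / √(n : ℝ)) ∧
          treeProb φ n (PlaneIncreasingTree.Lam (k n) σ)
            = regIncBeta (1 - σ) ((k n : ℝ) - 1) α * (1 + ε) := by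
  obtain ⟨K, hK, h⟩ := exists_abs_treeProb_lam_sub_le hc hα hδ hy
  refine ⟨K, fun k hk => ?_⟩
  have hlim := tendsto_sq_div_sqrt hk
  have h1 := hlim.eventually (ge_mem_nhds one_pos)
  have h2 := (hlim.const_mul K).eventually (ge_mem_nhds (by simp : K * 0 < 1))
  filter_upwards [h1, h2, eventually_ge_atTop 1] with n hn1 hn2 hn σ hσ hσδ hkn
  have hn' : (1 : ℝ) ≤ n := by exact_mod_cast hn
  have hsq : √(n : ℝ) ≤ n := Real.sqrt_le_self_iff.2 (.inr hn')
  have hsq0 : 0 < √(n : ℝ) := by positivity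
  have hle : (k n : ℝ) ^ 2 / n ≤ (k n : ℝ) ^ 2 / √(n : ℝ) := by gcongr
  have hkn' : k n ≤ n := by
    have : (k n : ℝ) ^ 2 ≤ n := by
      rw [div_le_one hsq0] at hn1
      exact hn1.trans hsq
    have : k n ^ 2 ≤ n := by exact_mod_cast this
    exact (Nat.le_self_pow two_ne_zero _).trans this
  obtain ⟨hpos, hab⟩ := h n (k n) σ hσ hσδ hkn hkn' (le_trans (by gcongr) hn2)
  refine ⟨treeProb φ n (PlaneIncreasingTree.Lam (k n) σ) /
    regIncBeta (1 - σ) ((k n : ℝ) - 1) α - 1, ?_, ?_⟩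
  · rw [div_sub_one hpos.ne', abs_div, abs_of_pos hpos, div_le_iff₀ hpos]
    exact hab.trans (by gcongr)
  · rw [add_sub_cancel, mul_div_cancel₀ _ hpos.ne']


theorem mainTheorem1 (φ : ℕ → ℝ) (c₁ α : ℝ) (hc₁ : 0 < c₁) (hα : 0 < α)
    (hy : PowerSeries.derivative ℝ (treeEGF φ) = oneSubPow c₁ α) :
    (∀ δ : ℝ, 0 < δ → δ < 1 / 2 →
      ∃ C : ℝ, ∀ k : ℕ → ℕ,
        (fun n => (k n : ℝ)) =o[atTop] (fun n : ℕ => (n : ℝ) ^ (1 / 4 : ℝ)) →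
        ∀ᶠ n : ℕ in atTop, ∀ σ : ℝ, 1 / 2 ≤ σ → σ < 1 - δ →
          1 < k n → k n < ⌈(1 - σ) * (n : ℝ)⌉₊ →
          ∃ ε : ℝ, |ε| ≤ C * ((k n : ℝ) ^ 2 / √(n : ℝ)) ∧
            treeProb φ n (PlaneIncreasingTree.Lam (k n) σ)
              = regIncBeta (1 - σ) ((k n : ℝ) - 1) α * (1 + ε)) ∧
    (∃ C : ℝ, ∀ k : ℕ → ℕ, (∀ᶠ n : ℕ in atTop, 1 < k n) →
      (fun n => (k n : ℝ)) =o[atTop] (fun n : ℕ => (n : ℝ) ^ (1 / 4 : ℝ)) →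
      (∀ᶠ n : ℕ in atTop,
        ∃ ε : ℝ, |ε| ≤ C * ((k n : ℝ) ^ 2 / √(n : ℝ)) ∧
          treeProb φ n (PlaneIncreasingTree.OnCentroidPath (k n))
            = regIncBeta (1 / 2) ((k n : ℝ) - 1) α * (1 + ε)) ∧
      (fun n => treeProb φ n (PlaneIncreasingTree.Lam (k n) (1 / 2)))
        ~[atTop] (fun n => regIncBeta (1 / 2) ((k n : ℝ) - 1) α)) := by
  refine ⟨fun δ hδ _ => ?_, ?_⟩
  · obtain ⟨C, hC⟩ := eventually_treeProb_lam hc₁ hα hδ hy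
    refine ⟨C, fun k hk => ?_⟩
    filter_upwards [hC k hk] with n hn σ hσ hσδ hkn _
    exact hn σ hσ hσδ.le hkn
  · obtain ⟨C, hC⟩ := eventually_treeProb_lam hc₁ hα (δ := 1 / 2) (by norm_num) hy
    refine ⟨C, fun k hk1 hk => ?_⟩
    have hmain : ∀ᶠ n : ℕ in atTop, ∃ ε : ℝ, |ε| ≤ C * ((k n : ℝ) ^ 2 / √(n : ℝ)) ∧
        treeProb φ n (PlaneIncreasingTree.Lam (k n) (1 / 2))
          = regIncBeta (1 / 2) ((k n : ℝ) - 1) α * (1 + ε) := by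
      filter_upwards [hC k hk, hk1] with n hn hkn
      obtain ⟨ε, hε, h⟩ := hn (1 / 2) le_rfl (by norm_num) hkn
      rw [sub_half] at h
      exact ⟨ε, hε, h⟩
    refine ⟨?_, ?_⟩
    · filter_upwards [hmain] with n hn
      rwa [show PlaneIncreasingTree.OnCentroidPath (n := n) (k n) =
        PlaneIncreasingTree.Lam (k n) (1 / 2) from
          funext fun T => propext (T.onCentroidPath_iff_lam (k n))]
    · refine IsLittleO.of_bound fun e he => ?_
      have hlim := ((tendsto_sq_div_sqrt hk).const_mul C).eventually
        (ge_mem_nhds (by simpa using he : C * 0 < e))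
      filter_upwards [hmain, hlim] with n ⟨ε, hε, h⟩ hle
      rw [Pi.sub_apply, h, mul_add, mul_one, add_sub_cancel_left, norm_mul, mul_comm]
      exact mul_le_mul_of_nonneg_right (hε.trans hle) (norm_nonneg _)
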